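/- **Definitions.** Let $V=\{1,\dots,n\}$, $[L]=\{1,\dots,L\}$. For a graph $G$ on $V$ let $N(v)$ be the set of neighbours of $v$, and for $S\subseteq V$ let $N(S)=\{u\notin S: u\text{ has a neighbour in }S\}$. *Adaptive exposure.* An adaptive vertex exposure process on a graph $G$ maintains a set $S$ of exposed vertices, initially empty. It first exposes an arbitrary vertex; afterwards, depending only on the vertices exposed so far and all edges incident to them, it either stops or exposes some vertex of $N(S)$. A set $S$ reached in this way is called adaptively exposed. *$d$-light.* Let $d>0$ be real. A random graph $G$ on $V$ is $d$-light if for every adaptively exposed $S$, conditioned on any instantiation (of positive probability) of $S$, of $S\cup N(S)$ and of the set of edges incident to $S$, and for every $v\in N(S)$ (any $v\in V$ if $S=\emptyset$), there is an integer $\alpha$ with $d\le\alpha\le n$ such that $|N(v)\setminus S|$ is stochastically dominated by the binomial distribution $B(\alpha,d/\alpha)$, i.e. $\Pr[|N(v)\setminus S|>x]\le\Pr[B(\alpha,d/\alpha)>x]$ for all real $x$. *Adaptive $k$-wise $\varepsilon$-dependence.* A random function $h:V\to[L]$ (e.g. a uniformly random member of a family of functions) is adaptive $k$-wise $\varepsilon$-dependent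 if every computationally unbounded adaptive distinguisher that makes at most $k$ queries to its oracle satisfies $|\Pr[\mathcal D^{h}=1]-\Pr[\mathcal D^{g}=1]|\le\varepsilon$, where $g:V\to[L]$ is uniformly random. *Relevant vicinity.* Given $G$ and $h:V\to[L]$, order the vertices lexicographically by the pairs $(h(u),u)$. The relevant vicinity of $v$ is the smallest set that contains $v$ and that contains, with each vertex $u$, every neighbour of $u$ that precedes $u$ in this ordering. **Theorem.** There is an absolute constant $c_0>0$ such that for every $c\ge c_0$ the following holds. Let $n\ge 2$, let $d>0$ be real, let $G$ be a $d$-light random graph on $V=\{1,\dots,n\}$, and let $L$ be an integer with $L>24d$. Put $\kappa=2^{L}c\log n$ and $k=6d\kappa$. Let $h:V\to[L]$ be an adaptive $k$-wise $\frac1{2n^5}$-dependent random function, independent of $G$. Then for every vertex $v$, with probability (over $G$ and $h$) at least $$1-\frac1{n^4}+\frac1{n^5}$$ the relevant vicinity of $v$ has size at most $\kappa$. -/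

import Mathlib

open MeasureTheory ProbabilityTheory

/-! ### Adaptive vertex exposure and `d`-light graph distributions -/

/-- The neighbourhood `N(S)` of a set of vertices (disjoint from `S`). -/
def nbhd {V : Type*} (G : SimpleGraph V) (S : Set V) : Set V :=
  {u | u ∉ S ∧ ∃ w ∈ S, G.Adj w u}

/-- The graph on `V` whose edges are the edges of `G` with at least one endpoint in `S`
(the edge set `E_S`). -/
def revealed {V : Type*} (G : SimpleGraph V) (S : Set V) : SimpleGraph V where
  Adj u w := G.Adj u w ∧ (u ∈ S ∨ w ∈ S)
  symm := ⟨fun _ _ h => ⟨h.1.symm, h.2.symm⟩⟩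
  loopless := ⟨fun u h => G.loopless.irrefl u h.1⟩

/-- An adaptive vertex exposure process: given the vertices exposed so far (latest first) and all
edges incident to them, it either stops (`none`) or names the next vertex to expose.
There is no computational restriction. -/
abbrev ExposureProcess (V : Type*) := List V → SimpleGraph V → Option V

open Classical in
/-- The vertices exposed by the process `P` on `G` within the first `t` iterations (latest first).
The first exposed vertex is arbitrary; later ones have to lie in the neighbourhood of the set
exposed so far (the process halts if it names any other vertex). -/
noncomputable def exposedList {V : Type*} (P : ExposureProcess V) (G : SimpleGraph V) :
    ℕ → List V
  | 0 => []
  | t + 1 =>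
    let l := exposedList P G t
    match P l (revealed G {x | x ∈ l}) with
    | none => l
    | some v => if l = [] ∨ v ∈ nbhd G {x | x ∈ l} then v :: l else l

/-- The set of vertices exposed by `P` on `G` within the first `t` iterations. -/
def exposedSet {V : Type*} (P : ExposureProcess V) (G : SimpleGraph V) (t : ℕ) : Set V :=
  {x | x ∈ exposedList P G t}

/-- (First-order) stochastic dominance: `μ` is stochastically dominated by `ν`. -/
def StochDominatedBy (μ ν : Measure ℝ) : Prop :=
  ∀ x : ℝ, μ (Set.Ioi x) ≤ ν (Set.Ioi x)

/-- The event that `P` has exposed exactly `S` after `t` iterations, with `S ∪ N(S) = T` and with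
`R` the graph formed by the edges incident to `S`. -/
def exposureEvent {V : Type*} (P : ExposureProcess V) (t : ℕ) (S T : Set V)
    (R : SimpleGraph V) : Set (SimpleGraph V) :=
  {G | exposedSet P G t = S ∧ S ∪ nbhd G S = T ∧ revealed G S = R}

/-- A distribution `𝒢` on graphs with vertex set `V` is `d`-light: for every adaptively exposed
set `S`, conditioned on any (positive probability) instantiation of `S`, `S ∪ N(S)` and of the
edges incident to `S`, for every `v ∈ N(S)` (any `v` if `S = ∅`) there is an integer
`d ≤ α ≤ |V|` such that `|N(v) \ S|` is stochastically dominated by `B(α, d / α)`. -/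
def IsLight {V : Type*} [Fintype V] (𝒢 : Measure (SimpleGraph V)) (d : ℝ) : Prop :=
  0 < d ∧
  ∀ (P : ExposureProcess V) (t : ℕ) (S T : Set V) (R : SimpleGraph V),
    𝒢 (exposureEvent P t S T R) ≠ 0 →
    ∀ v : V, (S = ∅ ∨ v ∈ T \ S) →
      ∃ (α : ℕ) (p : unitInterval), d ≤ α ∧ α ≤ Fintype.card V ∧ (p : ℝ) = d / α ∧
        StochDominatedBy
          ((cond 𝒢 (exposureEvent P t S T R)).map
            (fun G => ((G.neighborSet v \ S).ncard : ℝ)))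
          ((binomial α p).map (Nat.cast : ℕ → ℝ))

/-! ### Almost adaptive `k`-wise independent hash functions -/

/-- A (computationally unbounded) adaptive distinguisher with oracle access to a function
`V → R`: it outputs a bit, or queries a point and continues depending on the reply. -/
inductive Distinguisher (V R : Type*) where
  | output (b : Bool) : Distinguisher V R
  | query (x : V) (next : R → Distinguisher V R) : Distinguisher V R

/-- The output bit of a distinguisher on the oracle `F`. -/
def Distinguisher.run {V R : Type*} (F : V → R) : Distinguisher V R → Bool
  | .output b => b
  | .query x next => (next (F x)).run F

/-- The number of queries a distinguisher makes on the oracle `F`. -/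
def Distinguisher.numQueries {V R : Type*} (F : V → R) : Distinguisher V R → ℕ
  | .output _ => 0
  | .query x next => (next (F x)).numQueries F + 1

/-- A random function `V → R` with law `ℋ` is `ε`-almost adaptive `k`-wise independent
(adaptive `k`-wise `ε`-dependent): no distinguisher making at most `k` queries tells it apart
from a uniformly random function with advantage larger than `ε`. -/
def IsAdaptiveDependent {V R : Type*} [MeasurableSpace R] (ℋ : Measure (V → R))
    (k : ℕ) (ε : ℝ) : Prop :=
  ∀ D : Distinguisher V R, (∀ F, D.numQueries F ≤ k) →
    |ℋ.real {F | D.run F = true} -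
      ({F : V → R | D.run F = true}.ncard : ℝ) / (Nat.card (V → R) : ℝ)| ≤ ε

/-! ### Relevant vicinity -/

/-- `w` comes before `u` in the ordering induced by `h`, i.e. `(h w, w)` is lexicographically
smaller than `(h u, u)`. -/
def Precedes {V R : Type*} [LT V] [LT R] (h : V → R) (w u : V) : Prop :=
  toLex (h w, w) < toLex (h u, u)

/-- Membership in the relevant vicinity of `v`: it contains `v`, and with `u` every neighbour of
`u` that comes before `u` in the ordering induced by `h`. -/
inductive InRelevantVicinity {V R : Type*} [LT V] [LT R] (G : SimpleGraph V) (h : V → R)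
    (v : V) : V → Prop
  | base : InRelevantVicinity G h v v
  | step {u w : V} : InRelevantVicinity G h v u → G.Adj u w → Precedes h w u →
      InRelevantVicinity G h v w

/-- The relevant vicinity of `v` in `G` relative to `h`. -/
def relevantVicinity {V R : Type*} [LT V] [LT R] (G : SimpleGraph V) (h : V → R) (v : V) :
    Set V :=
  {w | InRelevantVicinity G h v w}

/-! Put m = c log n, so κ = 2^L m, and let K be the integer part of κ. The relevant vicinity of `v`
lies inside the set reached from `v` along paths with nonincreasing labels, where ties are ignored
and `v` counts as carrying an infinite label. `descentProcess` exposes this set, always choosing a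
candidate of largest label, so the labels appear in nonincreasing order (`descentProcess_sorted`).
If it halts within K iterations, the vicinity has at most κ vertices.

Suppose it does not halt, and compare the number of exposed vertices in the top j label classes
(plus `v`) with 2^j m. The bound holds for j = 0 and fails for j = L. At the first failure j + 1,
monotonicity puts the first t = ⌊2^(j+1) m⌋ + 1 exposed vertices all in the top j + 1 classes, and
at least half of them carry one single label (`exists_crowded_label`). For uniform labels this is
very unlikely: t exposures see about td vertices, of which a fixed label gets a fraction 1/L, fewer
than t/24.

The Chernoff bound behind this is `sum_sum_seenWeight_le`. The product of the weights of all seen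
vertices grows in mean by at most exp(d(b - 1)) per iteration, where b is the mean weight of a
label. Labels of newly seen vertices have not yet influenced the process, so they average out
independently; the number of newly seen vertices has, by `d`-lightness, at most the exponential
moments of a binomial variable of mean d.

For a fixed graph, a distinguisher can simulate the process by querying the labels of seen vertices,
accepting at once if there would be more than 6dκ of them (`simulate_spec`). Hence under `ℋ` the
probability of not halting is at most the sum of the uniform probabilities of not halting and of
seeing too much, plus ε. Seeing too much has probability about exp(-3dκ), which is useless for tiny
d; when d < 1/24 the whole component of `v` is already small, whatever the labels. -/

section Exposure

/-! ### Exposure processes: determinism, locality and halting. -/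

variable {V R : Type*}

/-- The exposed vertices together with their neighbours. -/
def seenSet (P : ExposureProcess V) (G : SimpleGraph V) (t : ℕ) : Set V :=
  exposedSet P G t ∪ nbhd G (exposedSet P G t)

open Classical in
/-- One iteration of an exposure process. -/
noncomputable def exposeStep (P : ExposureProcess V) (G : SimpleGraph V) (l : List V) : List V :=
  match P l (revealed G {x | x ∈ l}) with
  | none => l
  | some v => if l = [] ∨ v ∈ nbhd G {x | x ∈ l} then v :: l else l

theorem exposedList_succ (P : ExposureProcess V) (G : SimpleGraph V) (t : ℕ) :
    exposedList P G (t + 1) = exposeStep P G (exposedList P G t) := rfl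

theorem exposeStep_cases (P : ExposureProcess V) (G : SimpleGraph V) (l : List V) :
    exposeStep P G l = l ∨ ∃ u, P l (revealed G {x | x ∈ l}) = some u ∧
      (l = [] ∨ u ∈ nbhd G {x | x ∈ l}) ∧ exposeStep P G l = u :: l := by
  unfold exposeStep
  split
  · exact Or.inl rfl
  · rename_i u hu
    split_ifs with h
    · exact Or.inr ⟨u, hu, h, rfl⟩
    · exact Or.inl rfl

theorem exposeStep_of_some {P : ExposureProcess V} {G : SimpleGraph V} {l : List V} {u : V}
    (hP : P l (revealed G {x | x ∈ l}) = some u) (hu : l = [] ∨ u ∈ nbhd G {x | x ∈ l}) :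
    exposeStep P G l = u :: l := by
  simp [exposeStep, hP, hu]

theorem nbhd_subset_of_subset (G : SimpleGraph V) {S S' : Set V} (h : S ⊆ S') :
    S ∪ nbhd G S ⊆ S' ∪ nbhd G S' := by
  rintro x (hx | ⟨hx, w, hw, ha⟩)
  · exact Or.inl (h hx)
  · by_cases hx' : x ∈ S'
    · exact Or.inl hx'
    · exact Or.inr ⟨hx', w, h hw, ha⟩

theorem nbhd_revealed (G : SimpleGraph V) (S : Set V) : nbhd (revealed G S) S = nbhd G S := by
  ext u
  simp only [nbhd, revealed, Set.mem_ofPred_eq]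
  grind

theorem revealed_revealed (G : SimpleGraph V) {S S' : Set V} (h : S ⊆ S') :
    revealed (revealed G S') S = revealed G S := by
  ext u w
  simp only [revealed]
  grind

theorem revealed_congr_subset {G G' : SimpleGraph V} {S S' : Set V} (h : S ⊆ S')
    (hR : revealed G S' = revealed G' S') : revealed G S = revealed G' S := by
  rw [← revealed_revealed G h, hR, revealed_revealed G' h]

theorem nbhd_congr_revealed {G G' : SimpleGraph V} {S : Set V}
    (hR : revealed G S = revealed G' S) : nbhd G S = nbhd G' S := by
  rw [← nbhd_revealed G, hR, nbhd_revealed G']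

theorem exposeStep_congr_revealed (P : ExposureProcess V) {G G' : SimpleGraph V} {l : List V}
    (hR : revealed G {x | x ∈ l} = revealed G' {x | x ∈ l}) :
    exposeStep P G l = exposeStep P G' l := by
  have h := nbhd_congr_revealed hR
  unfold exposeStep
  rw [hR]
  cases P l (revealed G' {x | x ∈ l}) with
  | none => rfl
  | some v =>
    dsimp only
    rw [h]

theorem subset_exposeStep (P : ExposureProcess V) (G : SimpleGraph V) (l : List V) :
    l ⊆ exposeStep P G l := by
  rcases exposeStep_cases P G l with h | ⟨u, -, -, h⟩ <;> rw [h]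
  · exact List.Subset.refl _
  · exact List.subset_cons_self u l

theorem exposedList_subset_succ (P : ExposureProcess V) (G : SimpleGraph V) (t : ℕ) :
    exposedSet P G t ⊆ exposedSet P G (t + 1) := fun _ hx =>
  subset_exposeStep P G (exposedList P G t) hx

theorem exposedSet_mono (P : ExposureProcess V) (G : SimpleGraph V) :
    Monotone (exposedSet P G) := monotone_nat_of_le_succ (exposedList_subset_succ P G)

theorem seenSet_mono (P : ExposureProcess V) (G : SimpleGraph V) :
    Monotone (seenSet P G) := fun _ _ h => nbhd_subset_of_subset G (exposedSet_mono P G h)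

/-- The trace of a process is determined by the edges incident to the exposed vertices. -/
theorem exposedList_congr_revealed (P : ExposureProcess V) {G G' : SimpleGraph V} {S : Set V}
    (hR : revealed G S = revealed G' S) (t : ℕ) (hS : exposedSet P G t ⊆ S) :
    exposedList P G t = exposedList P G' t := by
  induction t with
  | zero => rfl
  | succ t ih =>
    have hS' := (exposedList_subset_succ P G t).trans hS
    rw [exposedList_succ, exposedList_succ, ← ih hS']
    exact exposeStep_congr_revealed P (revealed_congr_subset hS' hR)

/-- A family of exposure processes indexed by labellings, the decisions of which depend only on
the labels of the vertices seen so far. -/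
def IsLocalFamily (P : (V → R) → ExposureProcess V) : Prop :=
  ∀ (g g' : V → R) (G : SimpleGraph V) (l : List V),
    (∀ x ∈ {x | x ∈ l} ∪ nbhd G {x | x ∈ l}, g x = g' x) →
      P g l (revealed G {x | x ∈ l}) = P g' l (revealed G {x | x ∈ l})

theorem IsLocalFamily.exposeStep_congr {P : (V → R) → ExposureProcess V} (hP : IsLocalFamily P)
    {g g' : V → R} {G : SimpleGraph V} {l : List V}
    (h : ∀ x ∈ {x | x ∈ l} ∪ nbhd G {x | x ∈ l}, g x = g' x) :
    exposeStep (P g) G l = exposeStep (P g') G l := by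
  simp only [exposeStep, hP g g' G l h]

/-- The shift in the index is the point: the list after `t + 1` iterations uses only labels of
vertices seen after `t`. Labels of vertices first seen in iteration `t + 1` are thus still untouched
when that iteration is over. -/
theorem IsLocalFamily.exposedList_succ_congr {P : (V → R) → ExposureProcess V}
    (hP : IsLocalFamily P) {g g' : V → R} {G : SimpleGraph V} {t : ℕ}
    (h : ∀ x ∈ seenSet (P g) G t, g x = g' x) :
    exposedList (P g) G (t + 1) = exposedList (P g') G (t + 1) := by
  induction t with
  | zero => exact hP.exposeStep_congr h
  | succ t ih =>
    have hl := ih fun x hx => h x (seenSet_mono _ _ (Nat.le_succ t) hx)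
    rw [exposedList_succ (P g), exposedList_succ (P g'), ← hl]
    exact hP.exposeStep_congr h

theorem IsLocalFamily.exposedList_congr {P : (V → R) → ExposureProcess V}
    (hP : IsLocalFamily P) {g g' : V → R} {G : SimpleGraph V} {t : ℕ}
    (h : ∀ x ∈ seenSet (P g) G t, g x = g' x) :
    exposedList (P g) G t = exposedList (P g') G t := by
  cases t with
  | zero => rfl
  | succ t =>
    exact hP.exposedList_succ_congr fun x hx => h x (seenSet_mono _ _ (Nat.le_succ t) hx)

theorem exposedList_nodup (P : ExposureProcess V) (G : SimpleGraph V) (t : ℕ) :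
    (exposedList P G t).Nodup := by
  induction t with
  | zero => exact List.nodup_nil
  | succ t ih =>
    rw [exposedList_succ]
    rcases exposeStep_cases P G (exposedList P G t) with h | ⟨u, -, hu, h⟩ <;> rw [h]
    · exact ih
    · refine List.nodup_cons.2 ⟨?_, ih⟩
      rcases hu with hu | hu
      · simp [hu]
      · exact hu.1

theorem length_exposedList_le (P : ExposureProcess V) (G : SimpleGraph V) (t : ℕ) :
    (exposedList P G t).length ≤ t := by
  induction t with
  | zero => simp [exposedList]
  | succ t ih =>
    rw [exposedList_succ]
    rcases exposeStep_cases P G (exposedList P G t) with h | ⟨u, -, -, h⟩ <;> rw [h]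
    · omega
    · simpa using ih

/-- For fixed `P` and `G` an iteration is a function of the current list alone, so a list that
repeats once is a fixed point. -/
theorem exposedList_add_of_halt {P : ExposureProcess V} {G : SimpleGraph V} {t : ℕ}
    (h : exposedList P G (t + 1) = exposedList P G t) (s : ℕ) :
    exposedList P G (t + s) = exposedList P G t := by
  induction s with
  | zero => rfl
  | succ s ih => rw [← add_assoc, exposedList_succ, ih, ← exposedList_succ, h]

/-- A process that has not halted exposes one vertex per iteration. -/
theorem length_exposedList_of_not_halt {P : ExposureProcess V} {G : SimpleGraph V} {K : ℕ}
    (h : exposedList P G (K + 1) ≠ exposedList P G K) {t : ℕ} (ht : t ≤ K + 1) :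
    (exposedList P G t).length = t := by
  induction t with
  | zero => simp [exposedList]
  | succ t ih =>
    have ih := ih (by omega)
    rcases exposeStep_cases P G (exposedList P G t) with h' | ⟨u, -, -, h'⟩
    · refine absurd ?_ h
      have := exposedList_add_of_halt (P := P) (G := G) (t := t) h'
      obtain ⟨s, rfl⟩ := Nat.exists_eq_add_of_le (show t ≤ K by omega)
      rw [add_assoc, this, this]
    · rw [exposedList_succ, h', List.length_cons, ih]

theorem exposedList_suffix (P : ExposureProcess V) (G : SimpleGraph V) {s t : ℕ} (h : s ≤ t) :
    exposedList P G s <:+ exposedList P G t := by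
  induction t, h using Nat.le_induction with
  | base => exact List.suffix_refl _
  | succ t _ ih =>
    rw [exposedList_succ]
    rcases exposeStep_cases P G (exposedList P G t) with h | ⟨u, -, -, h⟩ <;> rw [h]
    · exact ih
    · exact ih.trans (List.suffix_cons u _)

theorem mem_exposedList_of_starts {P : ExposureProcess V} {v : V} (hv : ∀ H, P [] H = some v)
    (G : SimpleGraph V) (t : ℕ) : v ∈ exposedList P G (t + 1) := by
  refine exposedSet_mono P G (Nat.le_add_left 1 t) ?_
  have : exposedList P G 1 = [v] := exposeStep_of_some (hv _) (Or.inl rfl)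
  simp [exposedSet, this]

theorem mem_exposedList_of_ne_nil {P : ExposureProcess V} {v : V} (hv : ∀ H, P [] H = some v)
    {G : SimpleGraph V} {t : ℕ} (h : exposedList P G t ≠ []) : v ∈ exposedList P G t := by
  cases t with
  | zero => exact absurd rfl h
  | succ t => exact mem_exposedList_of_starts hv G t

theorem exposedSet_subset_seenSet (P : ExposureProcess V) (G : SimpleGraph V) (t : ℕ) :
    exposedSet P G t ⊆ seenSet P G t := Set.subset_union_left

/-- Exposing `u` only reveals neighbours of `u` outside the set exposed before. -/
theorem seenSet_succ_subset {P : ExposureProcess V} {v : V} (hv : ∀ H, P [] H = some v)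
    {G : SimpleGraph V} {t : ℕ} {u : V} (hu : exposedList P G (t + 1) = u :: exposedList P G t)
    (hu' : exposedList P G t = [] ∨ u ∈ nbhd G (exposedSet P G t)) :
    (seenSet P G (t + 1) \ seenSet P G t) \ {v} ⊆ G.neighborSet u \ exposedSet P G t := by
  rintro x ⟨⟨hx, hxt⟩, hxv⟩
  have hS : x ∉ exposedSet P G t := fun h => hxt (Or.inl h)
  refine ⟨?_, hS⟩
  -- `u` itself is not new: it was already seen as a neighbour, unless it is the starting vertex
  -- `v`. This is why `v` is left out of all counts.
  have hux : x ≠ u := by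
    rintro rfl
    rcases hu' with h | h
    · have hx1 := mem_exposedList_of_starts hv G t
      rw [hu, h] at hx1
      exact hxv (List.mem_singleton.1 hx1).symm
    · exact hxt (Or.inr h)
  have hS' : exposedSet P G (t + 1) = insert u (exposedSet P G t) := by
    ext y; simp [exposedSet, hu]
  rw [seenSet, hS'] at hx
  rcases hx with hx | ⟨-, w, hw, ha⟩
  · rcases hx with hx | hx
    · exact absurd hx hux
    · exact absurd hx hS
  · rcases hw with rfl | hw
    · exact ha
    · exact absurd (Or.inr ⟨hS, w, hw, ha⟩) hxt

theorem seenSet_eq_of_exposedList_eq {P Q : ExposureProcess V} {G : SimpleGraph V} {t : ℕ}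
    (h : exposedList P G t = exposedList Q G t) : seenSet P G t = seenSet Q G t := by
  simp only [seenSet, exposedSet, h]

end Exposure

/-! ### Averaging over independent uniform labels. -/

section Independence

variable {V R : Type*} [Fintype V] [DecidableEq V] [Fintype R]

theorem sum_mul_apply_of_indep (a : R → ℝ) (u : V) (Φ : (V → R) → ℝ)
    (hΦ : ∀ g g' : V → R, (∀ x, x ≠ u → g x = g' x) → Φ g = Φ g') [Nonempty R] :
    ∑ g, Φ g * a (g u) = (∑ r, a r) / Fintype.card R * ∑ g, Φ g := by
  classical
  let e := (Equiv.funSplitAt u R).symm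
  obtain ⟨r₀⟩ := ‹Nonempty R›
  have he : ∀ r f, e (r, f) u = r := fun r f => by simp [e, Equiv.funSplitAt]
  have hΦe : ∀ r f, Φ (e (r, f)) = Φ (e (r₀, f)) := fun r f =>
    hΦ _ _ fun x hx => by simp [e, Equiv.funSplitAt, hx]
  have hR : (Fintype.card R : ℝ) ≠ 0 := by
    have : 0 < Fintype.card R := Fintype.card_pos_iff.2 ⟨r₀⟩
    positivity
  rw [← e.sum_comp, ← e.sum_comp, Fintype.sum_prod_type, Fintype.sum_prod_type]
  simp only [he, hΦe]
  simp only [← Finset.sum_mul, Finset.sum_const, Finset.card_univ, nsmul_eq_mul]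
  rw [← Finset.mul_sum]
  field_simp

/-- Coordinates are averaged out one at a time; the factors of the other coordinates are absorbed
into the function that does not involve the current one. -/
theorem sum_mul_prod_of_indep [Nonempty R] (a : R → ℝ) (A : Finset V) (Φ : (V → R) → ℝ)
    (hΦ : ∀ g g' : V → R, (∀ x, x ∉ A → g x = g' x) → Φ g = Φ g') :
    ∑ g, Φ g * ∏ u ∈ A, a (g u) = ((∑ r, a r) / Fintype.card R) ^ A.card * ∑ g, Φ g := by
  induction A using Finset.induction_on generalizing Φ with
  | empty => simp
  | insert u A hu ih =>
    have h1 := sum_mul_apply_of_indep a u (fun g => Φ g * ∏ x ∈ A, a (g x)) fun g g' h => by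
      rw [hΦ g g' fun x hx => h x (by grind)]
      congr 1
      exact Finset.prod_congr rfl fun x hx => by rw [h x (by grind)]
    have h2 := ih Φ fun g g' h => hΦ g g' fun x hx => h x (by grind)
    rw [h2] at h1
    rw [Finset.card_insert_of_notMem hu, pow_succ', mul_assoc, ← h1]
    refine Finset.sum_congr rfl fun g _ => ?_
    rw [Finset.prod_insert hu]
    ring

end Independence

/-! ### Exponential moments under stochastic dominance by a binomial variable. -/

section Dominance

/-- A telescoped geometric sum: it writes b^k as a combination, with nonnegative coefficients, of
the indicators of k > j, so that exponential moments become combinations of tail probabilities. -/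
theorem pow_eq_one_add_tsum {b : ℝ} (hb : 1 ≤ b) (k : ℕ) :
    ENNReal.ofReal (b ^ k) =
      1 + ∑' j : ℕ, ENNReal.ofReal ((b - 1) * b ^ j) * (Set.Ioi j).indicator 1 k := by
  have h : b ^ k = 1 + ∑ j ∈ Finset.range k, (b - 1) * b ^ j := by
    rw [← Finset.mul_sum, mul_geom_sum]; ring
  rw [tsum_eq_sum (s := Finset.range k), h, ENNReal.ofReal_add zero_le_one,
    ENNReal.ofReal_sum_of_nonneg, ENNReal.ofReal_one]
  · congr 1
    refine Finset.sum_congr rfl fun j hj => ?_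
    rw [Set.indicator_of_mem (by simpa using hj)]
    simp
  · intro j _
    have : 0 ≤ b := by linarith
    exact mul_nonneg (by linarith) (by positivity)
  · refine Finset.sum_nonneg fun j _ => ?_
    have : 0 ≤ b := by linarith
    exact mul_nonneg (by linarith) (by positivity)
  · intro j hj
    rw [Set.indicator_of_notMem (by simpa using hj), mul_zero]

theorem lintegral_pow {Ω : Type*} [MeasurableSpace Ω] (μ : Measure Ω) [IsProbabilityMeasure μ]
    {X : Ω → ℕ} (hX : Measurable X) {b : ℝ} (hb : 1 ≤ b) :
    ∫⁻ ω, ENNReal.ofReal (b ^ X ω) ∂μ =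
      1 + ∑' j : ℕ, ENNReal.ofReal ((b - 1) * b ^ j) *
        μ.map (fun ω => (X ω : ℝ)) (Set.Ioi (j : ℝ)) := by
  simp only [pow_eq_one_add_tsum hb]
  have hm : ∀ j : ℕ, Measurable fun ω => (Set.Ioi j).indicator (1 : ℕ → ENNReal) (X ω) := fun j =>
    (measurable_from_top (f := (Set.Ioi j).indicator (1 : ℕ → ENNReal))).comp hX
  rw [lintegral_add_left measurable_const, lintegral_tsum]
  · simp only [lintegral_const, measure_univ, mul_one]
    congr 2
    ext j
    rw [lintegral_const_mul _ (hm j), Measure.map_apply (by fun_prop) measurableSet_Ioi]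
    congr 1
    have : (fun ω => (Set.Ioi j).indicator (1 : ℕ → ENNReal) (X ω)) =
        ((fun ω => (X ω : ℝ)) ⁻¹' Set.Ioi (j : ℝ)).indicator 1 := by
      ext ω
      simp [Set.indicator]
    rw [this, lintegral_indicator_one]
    exact measurableSet_Ioi.preimage (by fun_prop)
  · exact fun j => ((hm j).const_mul _).aemeasurable

theorem lintegral_pow_le_of_stochDominatedBy {Ω Ω' : Type*} [MeasurableSpace Ω]
    [MeasurableSpace Ω'] {μ : Measure Ω} {ν : Measure Ω'} [IsProbabilityMeasure μ]
    [IsProbabilityMeasure ν] {X : Ω → ℕ} {Y : Ω' → ℕ} (hX : Measurable X) (hY : Measurable Y)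
    (h : StochDominatedBy (μ.map fun ω => (X ω : ℝ)) (ν.map fun ω => (Y ω : ℝ)))
    {b : ℝ} (hb : 1 ≤ b) :
    ∫⁻ ω, ENNReal.ofReal (b ^ X ω) ∂μ ≤ ∫⁻ ω, ENNReal.ofReal (b ^ Y ω) ∂ν := by
  rw [lintegral_pow μ hX hb, lintegral_pow ν hY hb]
  exact add_le_add le_rfl (ENNReal.tsum_le_tsum fun j => mul_le_mul' le_rfl (h j))

theorem integral_pow_binomial (α : ℕ) (p : unitInterval) (b : ℝ) :
    ∫ k, b ^ k ∂(binomial α p) = (1 + p * (b - 1)) ^ α := by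
  rw [integral_binomial, show 1 + (p : ℝ) * (b - 1) = p * b + (1 - p) by ring, add_pow,
    ← Nat.range_succ_eq_Iic]
  refine Finset.sum_congr rfl fun k _ => ?_
  rw [smul_eq_mul, mul_pow]
  ring

/-- From 1 + x ≤ exp x. The bound is free of `α`, so it is harmless that `α` varies with the history
and the vertex. -/
theorem lintegral_pow_binomial_le {α : ℕ} {p : unitInterval} {d b : ℝ} (hα : 0 < α)
    (hp : (p : ℝ) = d / α) (hb : 1 ≤ b) :
    ∫⁻ k, ENNReal.ofReal (b ^ k) ∂(binomial α p) ≤ ENNReal.ofReal (Real.exp (d * (b - 1))) := by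
  have hb0 : 0 ≤ b := by linarith
  rw [← ofReal_integral_eq_lintegral_ofReal (integrable_binomial _)
    (Filter.Eventually.of_forall fun k => by positivity), integral_pow_binomial]
  refine ENNReal.ofReal_le_ofReal ?_
  have h0 : 0 ≤ (p : ℝ) * (b - 1) := mul_nonneg p.2.1 (by linarith)
  calc (1 + (p : ℝ) * (b - 1)) ^ α ≤ Real.exp (p * (b - 1)) ^ α := by
        gcongr
        linarith [Real.add_one_le_exp ((p : ℝ) * (b - 1))]
    _ = Real.exp (d * (b - 1)) := by
        rw [← Real.exp_nat_mul, hp]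
        congr 1
        have : (α : ℝ) ≠ 0 := by positivity
        field_simp

end Dominance

/-! ### Every set of graphs on a finite vertex set is measurable. -/

section Measurability

instance {V : Type*} [Finite V] : DiscreteMeasurableSpace (SimpleGraph V) := by
  have : MeasurableSingletonClass (SimpleGraph V) := ⟨fun G => by
    have : ({G} : Set (SimpleGraph V)) = SimpleGraph.edgeSet ⁻¹' {G.edgeSet} := by
      ext H; simp
    rw [this]
    exact SimpleGraph.measurable_edgeSet (Set.toFinite _).measurableSet⟩
  infer_instance

end Measurability

/-! ### Exponential moments of the weight of the seen vertices. -/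

section Chernoff

open Classical

variable {V R : Type*} [Fintype V]

/-- The vertices other than `v` first seen in iteration `t + 1`. -/
noncomputable def freshSeen (P : ExposureProcess V) (v : V) (G : SimpleGraph V) (t : ℕ) :
    Finset V :=
  {u | u ∈ seenSet P G (t + 1) ∧ u ∉ seenSet P G t ∧ u ≠ v}

/-- The product of the weights of all vertices other than `v` seen in `t` iterations. -/
noncomputable def seenWeight (a : V → ℝ) (P : ExposureProcess V) (v : V) (G : SimpleGraph V)
    (t : ℕ) : ℝ :=
  ∏ u with u ∈ seenSet P G t ∧ u ≠ v, a u

theorem seenWeight_zero (a : V → ℝ) (P : ExposureProcess V) (v : V) (G : SimpleGraph V) :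
    seenWeight a P v G 0 = 1 := by
  simp [seenWeight, seenSet, exposedSet, exposedList, nbhd]

theorem seenWeight_succ (a : V → ℝ) (P : ExposureProcess V) (v : V) (G : SimpleGraph V) (t : ℕ) :
    seenWeight a P v G (t + 1) = seenWeight a P v G t * ∏ u ∈ freshSeen P v G t, a u := by
  unfold seenWeight freshSeen
  rw [← Finset.prod_union]
  · congr 1
    ext u
    have := @seenSet_mono _ P G t (t + 1) (Nat.le_succ t) u
    simp only [Finset.mem_filter, Finset.mem_univ, true_and, Finset.mem_union]
    tauto
  · rw [Finset.disjoint_left]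
    intro u
    simp only [Finset.mem_filter, Finset.mem_univ, true_and]
    tauto

theorem seenWeight_nonneg {a : V → ℝ} (ha : ∀ u, 0 ≤ a u) (P : ExposureProcess V) (v : V)
    (G : SimpleGraph V) (t : ℕ) : 0 ≤ seenWeight a P v G t :=
  Finset.prod_nonneg fun u _ => ha u

/-- Averaging over the labels of the vertices seen for the first time in iteration `t + 1`. -/
theorem sum_seenWeight_succ [Fintype R] [Nonempty R] {P : (V → R) → ExposureProcess V}
    (hP : IsLocalFamily P) (a : R → ℝ) (v : V) (G : SimpleGraph V) (t : ℕ) :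
    ∑ g, seenWeight (fun u => a (g u)) (P g) v G (t + 1) =
      ∑ g, seenWeight (fun u => a (g u)) (P g) v G t *
        ((∑ r, a r) / Fintype.card R) ^ (freshSeen (P g) v G t).card := by
  -- Labellings are grouped by the lists after `t` and `t + 1` iterations. On a class the set of
  -- newly seen vertices is constant, and by locality membership in the class does not depend on
  -- their labels.
  let key : (V → R) → List V × List V := fun g =>
    (exposedList (P g) G t, exposedList (P g) G (t + 1))
  have hmaps : ∀ g ∈ (Finset.univ : Finset (V → R)), key g ∈ Finset.univ.image key := fun g hg =>
    Finset.mem_image_of_mem key hg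
  rw [← Finset.sum_fiberwise_of_maps_to hmaps, ← Finset.sum_fiberwise_of_maps_to hmaps]
  refine Finset.sum_congr rfl fun y hy => ?_
  obtain ⟨g₀, -, rfl⟩ := Finset.mem_image.1 hy
  have hseen : ∀ g, key g = key g₀ → seenSet (P g) G t = seenSet (P g₀) G t := fun g hg =>
    seenSet_eq_of_exposedList_eq (Prod.ext_iff.1 hg).1
  have hfresh : ∀ g, key g = key g₀ → freshSeen (P g) v G t = freshSeen (P g₀) v G t := by
    intro g hg
    simp only [freshSeen, hseen g hg, seenSet_eq_of_exposedList_eq (Prod.ext_iff.1 hg).2]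
  set A := freshSeen (P g₀) v G t with hA
  have hkey : ∀ g g' : V → R, (∀ x, x ∉ A → g x = g' x) → key g = key g₀ → key g' = key g₀ ∧
      seenWeight (fun u => a (g u)) (P g) v G t = seenWeight (fun u => a (g' u)) (P g') v G t := by
    intro g g' h hg
    have hagree : ∀ x ∈ seenSet (P g) G t, g x = g' x := fun x hx => h x fun hxA => by
      rw [hseen g hg] at hx
      simp only [hA, freshSeen, Finset.mem_filter] at hxA
      exact hxA.2.2.1 hx
    have h1 := hP.exposedList_congr hagree
    refine ⟨?_, ?_⟩
    · rw [← hg]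
      exact Prod.ext h1.symm (hP.exposedList_succ_congr hagree).symm
    · unfold seenWeight
      rw [← seenSet_eq_of_exposedList_eq h1]
      refine Finset.prod_congr rfl fun u hu => ?_
      exact congrArg a (hagree u (Finset.mem_filter.1 hu).2.1)
  -- Applied to the old weight times the indicator of the class, neither of which involves the
  -- labels on `A`.
  have hmain := sum_mul_prod_of_indep a A
    (fun g => if key g = key g₀ then seenWeight (fun u => a (g u)) (P g) v G t else 0) (by
      intro g g' h
      by_cases hg : key g = key g₀
      · obtain ⟨h1, h2⟩ := hkey g g' h hg
        simp only [hg, h1, if_true, h2]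
      · have hg' : key g' ≠ key g₀ := fun hg' =>
          hg (hkey g' g (fun x hx => (h x hx).symm) hg').1
        simp only [hg, hg', if_false])
  simp only [ite_mul, zero_mul] at hmain
  rw [← Finset.sum_filter, ← Finset.sum_filter] at hmain
  rw [Finset.sum_congr rfl fun g hg => by
    rw [seenWeight_succ, hfresh g (Finset.mem_filter.1 hg).2], hmain, Finset.mul_sum]
  refine Finset.sum_congr rfl fun g hg => ?_
  rw [hfresh g (Finset.mem_filter.1 hg).2, mul_comm]

theorem card_freshSeen_le {P : ExposureProcess V} {v : V} (hv : ∀ H, P [] H = some v)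
    {G : SimpleGraph V} {t : ℕ} {u : V} (hu : exposedList P G (t + 1) = u :: exposedList P G t)
    (hu' : exposedList P G t = [] ∨ u ∈ nbhd G (exposedSet P G t)) :
    (freshSeen P v G t).card ≤ (G.neighborSet u \ exposedSet P G t).ncard := by
  rw [← Set.ncard_coe_finset]
  refine Set.ncard_le_ncard (fun x hx => seenSet_succ_subset hv hu hu' ?_) (Set.toFinite _)
  simp only [freshSeen, Finset.coe_filter, Finset.mem_univ, true_and, Set.mem_ofPred_eq] at hx
  exact ⟨⟨hx.1, hx.2.1⟩, hx.2.2⟩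

/-- Conditioned on the history, the number of newly seen vertices has the exponential moments
of a dominating binomial variable. -/
theorem sum_pow_card_freshSeen_le_of_fiber [Fintype (SimpleGraph V)]
    {𝒢 : Measure (SimpleGraph V)} [IsProbabilityMeasure 𝒢]
    {d : ℝ} (hlight : IsLight 𝒢 d) {P : ExposureProcess V} {v : V} (hv : ∀ H, P [] H = some v)
    (t : ℕ) {b : ℝ} (hb : 1 ≤ b) (G₀ : SimpleGraph V) {E : Set (SimpleGraph V)}
    (hE : E = exposureEvent P t (exposedSet P G₀ t) (seenSet P G₀ t)
      (revealed G₀ (exposedSet P G₀ t))) :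
    ∑ G with G ∈ E, 𝒢.real {G} * b ^ (freshSeen P v G t).card ≤
      Real.exp (d * (b - 1)) * ∑ G with G ∈ E, 𝒢.real {G} := by
  have hb0 : 0 ≤ b := by linarith
  have hd := hlight.1
  by_cases h0 : 𝒢 E = 0
  · have hz : ∀ G ∈ E, 𝒢.real {G} = 0 := fun G hG =>
      (measureReal_eq_zero_iff).2 (measure_mono_null (Set.singleton_subset_iff.2 hG) h0)
    rw [Finset.sum_eq_zero, Finset.sum_eq_zero, mul_zero]
    · exact fun G hG => hz G (Finset.mem_filter.1 hG).2
    · exact fun G hG => by rw [hz G (Finset.mem_filter.1 hG).2, zero_mul]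
  have hlist : ∀ G ∈ E, exposedList P G t = exposedList P G₀ t ∧
      exposedList P G (t + 1) = exposedList P G₀ (t + 1) ∧
      exposedSet P G t = exposedSet P G₀ t ∧ seenSet P G t = seenSet P G₀ t := by
    intro G hG
    rw [hE] at hG
    obtain ⟨h1, h2, h3⟩ := hG
    have hl := exposedList_congr_revealed P h3 t h1.le
    refine ⟨hl, ?_, h1, ?_⟩
    · rw [exposedList_succ, exposedList_succ, hl]
      exact exposeStep_congr_revealed P h3
    · rw [seenSet, h1, h2]
  -- On `E` the next move is the same for all graphs: either the process has halted and nothing new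
  -- is seen, or one fixed vertex `u` is exposed and `d`-lightness applies to it.
  rcases exposeStep_cases P G₀ (exposedList P G₀ t) with hst | ⟨u, -, hu, hst⟩
  · rw [Finset.mul_sum]
    refine Finset.sum_le_sum fun G hG => ?_
    obtain ⟨h1, h2, -, -⟩ := hlist G (Finset.mem_filter.1 hG).2
    have hhalt : exposedList P G (t + 1) = exposedList P G t := by
      rw [h2, exposedList_succ, hst, h1]
    have hf : freshSeen P v G t = ∅ := by
      ext x
      simp only [freshSeen, seenSet, exposedSet, hhalt, Finset.mem_filter, Finset.mem_univ,
        true_and, Finset.notMem_empty, iff_false]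
      tauto
    rw [hf, Finset.card_empty, pow_zero, mul_comm]
    refine mul_le_mul_of_nonneg_right (Real.one_le_exp ?_) measureReal_nonneg
    exact mul_nonneg hd.le (by linarith)
  · have hE0 : 𝒢 (exposureEvent P t (exposedSet P G₀ t) (seenSet P G₀ t)
      (revealed G₀ (exposedSet P G₀ t))) ≠ 0 := hE ▸ h0
    obtain ⟨α, p, hα, -, hp, hdom⟩ := hlight.2 P t _ _ _ hE0 u (by
      rcases hu with hu | hu
      · left
        simp [exposedSet, hu]
      · exact Or.inr ⟨Or.inr hu, hu.1⟩)
    rw [← hE] at hdom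
    have hαpos : 0 < α := by
      have : (0 : ℝ) < α := hd.trans_le hα
      exact_mod_cast this
    have hprob : IsProbabilityMeasure (cond 𝒢 E) := cond_isProbabilityMeasure h0
    have hlint := (lintegral_pow_le_of_stochDominatedBy (μ := cond 𝒢 E) (ν := binomial α p)
      (X := fun G => (G.neighborSet u \ exposedSet P G₀ t).ncard) (Y := id)
      Measurable.of_discrete measurable_id hdom hb).trans (lintegral_pow_binomial_le hαpos hp hb)
    -- Undoes the conditioning: both sides are multiplied by the measure of `E` and written as sums
    -- over single graphs.
    rw [ProbabilityTheory.cond, lintegral_smul_measure, smul_eq_mul,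
      ENNReal.inv_mul_le_iff h0 (measure_ne_top _ _), ← lintegral_indicator (.of_discrete),
      lintegral_fintype] at hlint
    have hfin : (𝒢 E) = ∑ G with G ∈ E, 𝒢 {G} := by
      rw [sum_measure_singleton]
      congr 1
      ext G; simp
    have hof : ∀ G, ENNReal.ofReal (𝒢.real {G}) = 𝒢 {G} := fun G => ofReal_measureReal
    have hsum : ENNReal.ofReal (∑ G with G ∈ E, 𝒢.real {G} *
        b ^ (G.neighborSet u \ exposedSet P G₀ t).ncard) ≤
        ENNReal.ofReal (Real.exp (d * (b - 1)) * ∑ G with G ∈ E, 𝒢.real {G}) := by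
      rw [ENNReal.ofReal_mul (Real.exp_nonneg _), ENNReal.ofReal_sum_of_nonneg,
        ENNReal.ofReal_sum_of_nonneg]
      · simp only [ENNReal.ofReal_mul measureReal_nonneg, hof]
        rw [← hfin, mul_comm (ENNReal.ofReal _) (𝒢 E)]
        refine le_trans (le_of_eq ?_) hlint
        rw [Finset.sum_filter]
        refine Finset.sum_congr rfl fun G _ => ?_
        by_cases hG : G ∈ E <;> simp [hG, mul_comm]
      · exact fun G _ => measureReal_nonneg
      · exact fun G _ => mul_nonneg measureReal_nonneg (by positivity)
    refine le_trans (Finset.sum_le_sum fun G hG => ?_) ((ENNReal.ofReal_le_ofReal_iff ?_).1 hsum)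
    · obtain ⟨h1, h2, h3, -⟩ := hlist G (Finset.mem_filter.1 hG).2
      refine mul_le_mul_of_nonneg_left (pow_le_pow_right₀ hb ?_) measureReal_nonneg
      rw [← h3]
      refine card_freshSeen_le hv (u := u) ?_ ?_
      · rw [h2, exposedList_succ, hst, h1]
      · rw [h1, h3]
        refine hu.imp id fun hu => ?_
        have hR : revealed G (exposedSet P G₀ t) = revealed G₀ (exposedSet P G₀ t) := by
          have := (Finset.mem_filter.1 hG).2
          rw [hE] at this
          exact this.2.2
        rw [nbhd_congr_revealed hR]
        exact hu
    · exact mul_nonneg (Real.exp_nonneg _) (Finset.sum_nonneg fun _ _ => measureReal_nonneg)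

/-- Averaging over the graph in one iteration. -/
theorem sum_mul_pow_card_freshSeen_le [Fintype (SimpleGraph V)]
    {𝒢 : Measure (SimpleGraph V)} [IsProbabilityMeasure 𝒢]
    {d : ℝ} (hlight : IsLight 𝒢 d) {P : ExposureProcess V} {v : V} (hv : ∀ H, P [] H = some v)
    (t : ℕ) {b : ℝ} (hb : 1 ≤ b) {a : V → ℝ} (ha : ∀ u, 0 ≤ a u) :
    ∑ G, 𝒢.real {G} * (seenWeight a P v G t * b ^ (freshSeen P v G t).card) ≤
      Real.exp (d * (b - 1)) * ∑ G, 𝒢.real {G} * seenWeight a P v G t := by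
  let key : SimpleGraph V → Set V × Set V × SimpleGraph V := fun G =>
    (exposedSet P G t, seenSet P G t, revealed G (exposedSet P G t))
  have hmaps : ∀ G ∈ (Finset.univ : Finset (SimpleGraph V)),
      key G ∈ Finset.univ.image key := fun G hG => Finset.mem_image_of_mem key hG
  rw [← Finset.sum_fiberwise_of_maps_to hmaps,
    ← Finset.sum_fiberwise_of_maps_to hmaps (fun G => 𝒢.real {G} * seenWeight a P v G t),
    Finset.mul_sum]
  refine Finset.sum_le_sum fun y hy => ?_
  obtain ⟨G₀, -, rfl⟩ := Finset.mem_image.1 hy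
  set E := exposureEvent P t (exposedSet P G₀ t) (seenSet P G₀ t)
      (revealed G₀ (exposedSet P G₀ t)) with hE
  have hfilter : ∀ G, key G = key G₀ ↔ G ∈ E := by
    intro G
    simp only [key, Prod.mk.injEq, hE, exposureEvent, seenSet, Set.mem_ofPred_eq]
    constructor
    · rintro ⟨h1, h2, h3⟩
      rw [h1] at h2 h3
      exact ⟨h1, h2, h3⟩
    · rintro ⟨h1, h2, h3⟩
      rw [h1]
      exact ⟨rfl, h2, h3⟩
  simp only [hfilter]
  have hw : ∀ G ∈ E, seenWeight a P v G t = seenWeight a P v G₀ t := by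
    intro G hG
    have : seenSet P G t = seenSet P G₀ t := (Prod.ext_iff.1 (Prod.ext_iff.1 ((hfilter G).2 hG)).2).1
    simp only [seenWeight, this]
  have := mul_le_mul_of_nonneg_left (sum_pow_card_freshSeen_le_of_fiber hlight hv t hb G₀ hE)
    (seenWeight_nonneg ha P v G₀ t)
  rw [Finset.mul_sum, Finset.mul_sum, Finset.mul_sum] at this
  rw [Finset.mul_sum]
  convert this using 1
  · refine Finset.sum_congr rfl fun G hG => ?_
    rw [hw G (Finset.mem_filter.1 hG).2]
    ring
  · refine Finset.sum_congr rfl fun G hG => ?_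
    rw [hw G (Finset.mem_filter.1 hG).2]
    ring

/-- Exponential moments of the weight of the vertices seen in `t` iterations on a `d`-light random
graph with uniformly random labels. -/
theorem sum_sum_seenWeight_le [Fintype (SimpleGraph V)]
    [Fintype R] [Nonempty R] {𝒢 : Measure (SimpleGraph V)}
    [IsProbabilityMeasure 𝒢] {d : ℝ} (hlight : IsLight 𝒢 d) {P : (V → R) → ExposureProcess V}
    (hP : IsLocalFamily P) {v : V} (hv : ∀ g H, P g [] H = some v) {a : R → ℝ}
    (ha : ∀ r, 0 ≤ a r) {b : ℝ} (hb : 1 ≤ b) (hab : (∑ r, a r) / Fintype.card R = b) (t : ℕ) :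
    ∑ G, 𝒢.real {G} * ∑ g, seenWeight (fun u => a (g u)) (P g) v G t ≤
      Real.exp (t * (d * (b - 1))) * Fintype.card (V → R) := by
  induction t with
  | zero =>
    simp only [seenWeight_zero, Finset.sum_const, Finset.card_univ, nsmul_eq_mul, mul_one]
    rw [← Finset.sum_mul]
    simp
  | succ t ih =>
    -- With the graph fixed, the new labels are averaged, leaving a power of `b`; the sums are then
    -- exchanged and, with the labels fixed, the graph is averaged.
    simp only [sum_seenWeight_succ hP a v, hab]
    simp only [Finset.mul_sum]
    rw [Finset.sum_comm]
    calc ∑ g : V → R, ∑ G, 𝒢.real {G} * (seenWeight (fun u => a (g u)) (P g) v G t *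
          b ^ (freshSeen (P g) v G t).card)
        ≤ ∑ g : V → R, Real.exp (d * (b - 1)) *
          ∑ G, 𝒢.real {G} * seenWeight (fun u => a (g u)) (P g) v G t :=
          Finset.sum_le_sum fun g _ =>
            sum_mul_pow_card_freshSeen_le hlight (hv g) t hb fun u => ha (g u)
      _ = Real.exp (d * (b - 1)) *
          ∑ G, 𝒢.real {G} * ∑ g, seenWeight (fun u => a (g u)) (P g) v G t := by
          rw [← Finset.mul_sum, Finset.sum_comm]
          simp only [Finset.mul_sum]
      _ ≤ Real.exp (d * (b - 1)) * (Real.exp (t * (d * (b - 1))) * Fintype.card (V → R)) := by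
          gcongr
      _ = Real.exp ((t + 1 : ℕ) * (d * (b - 1))) * Fintype.card (V → R) := by
          rw [← mul_assoc, ← Real.exp_add]
          push_cast
          ring_nf

end Chernoff

/-! ### Markov's inequality and the two tail bounds. -/

section Tail

open Classical

variable {V R : Type*} [Fintype V]

/-- Markov's inequality for the weight of the seen vertices. -/
theorem sum_mul_ncard_le_of_seenWeight_ge [Fintype (SimpleGraph V)] [Fintype R]
    [Nonempty R] {𝒢 : Measure (SimpleGraph V)}
    [IsProbabilityMeasure 𝒢] {d : ℝ} (hlight : IsLight 𝒢 d) {P : (V → R) → ExposureProcess V}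
    (hP : IsLocalFamily P) {v : V} (hv : ∀ g H, P g [] H = some v) {a : R → ℝ}
    (ha : ∀ r, 0 ≤ a r) {b : ℝ} (hb : 1 ≤ b) (hab : (∑ r, a r) / Fintype.card R = b) (t : ℕ)
    {τ : ℝ} (hτ : 0 < τ) {A : SimpleGraph V → (V → R) → Prop}
    (hA : ∀ G g, A G g → τ ≤ seenWeight (fun u => a (g u)) (P g) v G t) :
    ∑ G, 𝒢.real {G} * ({g | A G g}.ncard : ℝ) ≤
      Real.exp (t * (d * (b - 1))) / τ * Nat.card (V → R) := by
  have h := sum_sum_seenWeight_le hlight hP hv ha hb hab t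
  rw [← Nat.card_eq_fintype_card] at h
  rw [div_mul_eq_mul_div, le_div_iff₀ hτ]
  refine le_trans ?_ h
  rw [Finset.sum_mul]
  refine Finset.sum_le_sum fun G _ => ?_
  rw [mul_assoc]
  refine mul_le_mul_of_nonneg_left ?_ measureReal_nonneg
  calc ({g | A G g}.ncard : ℝ) * τ = ∑ g with A G g, τ := by
        rw [Finset.sum_const, nsmul_eq_mul, ← Set.ncard_coe_finset, Finset.coe_filter_univ]
    _ ≤ ∑ g with A G g, seenWeight (fun u => a (g u)) (P g) v G t :=
        Finset.sum_le_sum fun g hg => hA G g (Finset.mem_filter.1 hg).2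
    _ ≤ ∑ g, seenWeight (fun u => a (g u)) (P g) v G t :=
        Finset.sum_le_sum_of_subset_of_nonneg (Finset.filter_subset _ _) fun g _ _ =>
          seenWeight_nonneg (fun u => ha (g u)) _ _ _ _

/-- Tail bound for the number of vertices seen. -/
theorem sum_mul_ncard_le_of_card_seen [Fintype (SimpleGraph V)] [Fintype R]
    [Nonempty R] {𝒢 : Measure (SimpleGraph V)}
    [IsProbabilityMeasure 𝒢] {d : ℝ} (hlight : IsLight 𝒢 d) {P : (V → R) → ExposureProcess V}
    (hP : IsLocalFamily P) {v : V} (hv : ∀ g H, P g [] H = some v) {b : ℝ} (hb : 1 ≤ b)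
    (t : ℕ) (s : ℕ) {A : SimpleGraph V → (V → R) → Prop}
    (hA : ∀ G g, A G g → s ≤ (seenSet (P g) G t \ {v}).ncard) :
    ∑ G, 𝒢.real {G} * ({g | A G g}.ncard : ℝ) ≤
      Real.exp (t * (d * (b - 1))) / b ^ s * Nat.card (V → R) := by
  have hb0 : 0 < b := by linarith
  refine sum_mul_ncard_le_of_seenWeight_ge hlight hP hv (a := fun _ => b) (fun _ => hb0.le) hb
    (by simp) t (by positivity) fun G g hg => ?_
  rw [seenWeight, Finset.prod_const]
  refine pow_le_pow_right₀ hb ((hA G g hg).trans (le_of_eq ?_))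
  rw [← Set.ncard_coe_finset]
  congr 1
  ext x
  simp

/-- Tail bound for the number of vertices of a given label seen. -/
theorem sum_mul_ncard_le_of_card_label [Fintype (SimpleGraph V)] [Fintype R]
    [Nonempty R] {𝒢 : Measure (SimpleGraph V)}
    [IsProbabilityMeasure 𝒢] {d : ℝ} (hlight : IsLight 𝒢 d) {P : (V → R) → ExposureProcess V}
    (hP : IsLocalFamily P) {v : V} (hv : ∀ g H, P g [] H = some v) (r : R)
    {b : ℝ} (hb : 1 ≤ b) (t : ℕ) {s : ℝ} {A : SimpleGraph V → (V → R) → Prop}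
    (hA : ∀ G g, A G g → s ≤ ({u | u ∈ seenSet (P g) G t ∧ u ≠ v ∧ g u = r}.ncard : ℝ)) :
    ∑ G, 𝒢.real {G} * ({g | A G g}.ncard : ℝ) ≤
      Real.exp (t * (d * ((b - 1) / Fintype.card R))) / b ^ s * Nat.card (V → R) := by
  have hb0 : 0 < b := by linarith
  have hR : (0 : ℝ) < Fintype.card R := by exact_mod_cast Fintype.card_pos
  -- Label `r` has weight `b` and every other label weight 1, so the mean weight is 1 + (b - 1)/|R|,
  -- and the total weight is `b` to the number of seen vertices labelled `r`.
  have := sum_mul_ncard_le_of_seenWeight_ge hlight hP hv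
    (a := fun x => if x = r then b else 1) (b := 1 + (b - 1) / Fintype.card R)
    (fun x => by split_ifs <;> positivity)
    (by have : 0 ≤ (b - 1) / Fintype.card R := div_nonneg (by linarith) hR.le
        linarith)
    (by
      have : ∀ x, (if x = r then b else 1) = 1 + if x = r then b - 1 else 0 := fun x => by
        split_ifs <;> ring
      simp only [this, Finset.sum_add_distrib, Finset.sum_const, Finset.card_univ, nsmul_eq_mul,
        mul_one, Finset.sum_ite_eq', Finset.mem_univ, if_true]
      field_simp) t (τ := b ^ s) (by positivity) (A := A) (fun G g hg => by
      rw [seenWeight, Finset.prod_ite, Finset.prod_const_one, mul_one, Finset.prod_const,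
        ← Real.rpow_natCast]
      refine Real.rpow_le_rpow_of_exponent_le hb ((hA G g hg).trans (le_of_eq ?_))
      rw [← Set.ncard_coe_finset]
      congr 2
      ext x
      simp [and_assoc])
  rwa [add_sub_cancel_left] at this

end Tail

/-! ### Greedy processes, and the component of `v`. -/

section PickProcess

variable {V R : Type*}

open Classical in
/-- The exposure process that starts at `v` and then exposes vertices satisfying `Q`, as long as
there are some. -/
noncomputable def pickProcess (v : V) (Q : List V → SimpleGraph V → V → Prop) :
    ExposureProcess V := fun l H =>
  if l = [] then some v else if h : ∃ m, Q l H m then some h.choose else none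

theorem pickProcess_nil (v : V) (Q : List V → SimpleGraph V → V → Prop) (H : SimpleGraph V) :
    pickProcess v Q [] H = some v := by
  simp [pickProcess]

theorem pickProcess_congr {v : V} {Q Q' : List V → SimpleGraph V → V → Prop} {l : List V}
    {H : SimpleGraph V} (h : Q l H = Q' l H) : pickProcess v Q l H = pickProcess v Q' l H := by
  unfold pickProcess
  rw [h]

theorem pickProcess_spec {v : V} {Q : List V → SimpleGraph V → V → Prop} {l : List V}
    {H : SimpleGraph V} (hl : l ≠ []) {u : V} (hu : pickProcess v Q l H = some u) : Q l H u := by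
  unfold pickProcess at hu
  rw [if_neg hl] at hu
  split_ifs at hu with h
  rw [← Option.some_inj.1 hu]
  exact h.choose_spec

/-- When the process halts, no vertex satisfies `Q`. -/
theorem not_exists_of_halt {v : V} {Q : List V → SimpleGraph V → V → Prop}
    (hQ : ∀ l H m, Q l H m → m ∈ nbhd H {x | x ∈ l}) {G : SimpleGraph V} {K : ℕ}
    (h : exposedList (pickProcess v Q) G (K + 1) = exposedList (pickProcess v Q) G K) :
    v ∈ exposedList (pickProcess v Q) G K ∧
      ∀ m, ¬ Q (exposedList (pickProcess v Q) G K) (revealed G (exposedSet (pickProcess v Q) G K))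
        m := by
  have hv : v ∈ exposedList (pickProcess v Q) G K := by
    rw [← h]
    exact mem_exposedList_of_starts (pickProcess_nil v Q) G K
  refine ⟨hv, fun m hm => ?_⟩
  set l := exposedList (pickProcess v Q) G K with hl
  have hne : l ≠ [] := List.ne_nil_of_mem hv
  have hex : ∃ m, Q l (revealed G {x | x ∈ l}) m := ⟨m, hm⟩
  have hp : pickProcess v Q l (revealed G {x | x ∈ l}) = some hex.choose := by
    unfold pickProcess
    rw [if_neg hne, dif_pos hex]
  have := exposeStep_of_some hp (Or.inr (by
    rw [← nbhd_revealed]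
    exact hQ _ _ _ hex.choose_spec))
  rw [exposedList_succ, ← hl, this] at h
  exact absurd (congrArg List.length h) (by simp)

theorem ncard_exposedSet (P : ExposureProcess V) (G : SimpleGraph V) (t : ℕ) :
    (exposedSet P G t).ncard = (exposedList P G t).length := by
  classical
  rw [← List.toFinset_card_of_nodup (exposedList_nodup P G t), ← Set.ncard_coe_finset]
  congr 1
  ext x; simp [exposedSet]

/-- A set containing `v` and closed under steps to preceding neighbours contains the relevant
vicinity of `v`. -/
theorem relevantVicinity_subset [LT V] [LT R] {G : SimpleGraph V} {h : V → R} {v : V} {S : Set V}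
    (hv : v ∈ S) (hS : ∀ u ∈ S, ∀ w, G.Adj u w → Precedes h w u → w ∈ S) :
    relevantVicinity G h v ⊆ S := by
  intro w hw
  induction hw with
  | base => exact hv
  | step _ ha hp ih => exact hS _ ih _ ha hp

theorem Precedes.label_le [LinearOrder V] [LinearOrder R] {h : V → R} {w u : V}
    (hp : Precedes h w u) : h w ≤ h u := by
  rcases Prod.Lex.toLex_lt_toLex.1 hp with hlt | heq
  · exact hlt.le
  · exact heq.1.le

/-- The process exposing the connected component of `v`. -/
noncomputable def componentProcess (v : V) : ExposureProcess V :=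
  pickProcess v fun l H m => m ∈ nbhd H {x | x ∈ l}

/-- A component contains the vicinity for every labelling at once, so this process needs no
information about the labels. -/
theorem relevantVicinity_subset_of_componentProcess_halt [LT V] [LT R] {G : SimpleGraph V}
    {v : V} {K : ℕ}
    (h : exposedList (componentProcess v) G (K + 1) = exposedList (componentProcess v) G K)
    (g : V → R) : relevantVicinity G g v ⊆ exposedSet (componentProcess v) G K := by
  obtain ⟨hv, hno⟩ := not_exists_of_halt (fun _ _ _ h => h) h
  refine relevantVicinity_subset hv fun u hu w ha _ => ?_
  by_contra hw
  refine hno w ?_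
  rw [show {x | x ∈ exposedList (pickProcess v _) G K} = exposedSet (componentProcess v) G K
    from rfl, show pickProcess v _ = componentProcess v from rfl, nbhd_revealed]
  exact ⟨hw, u, hu, ha⟩

end PickProcess

/-! ### Descent with the largest label first. -/

section Descent

variable {V R : Type*} [LinearOrder R]

/-- The unexposed vertices that are adjacent to an exposed vertex other than `v` with a label at
least as large, or adjacent to `v`. -/
def descentCandidates (g : V → R) (v : V) (l : List V) (G : SimpleGraph V) : Set V :=
  {w | w ∉ l ∧ ∃ u ∈ l, G.Adj u w ∧ (u = v ∨ g w ≤ g u)}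

/-- The process that starts at `v` and explores paths with nonincreasing labels, taking the
largest label first. -/
noncomputable def descentProcess (v : V) (g : V → R) : ExposureProcess V :=
  pickProcess v fun l H m =>
    m ∈ descentCandidates g v l H ∧ ∀ w ∈ descentCandidates g v l H, g w ≤ g m

theorem descentCandidates_subset (g : V → R) (v : V) (l : List V) (G : SimpleGraph V) :
    descentCandidates g v l G ⊆ nbhd G {x | x ∈ l} :=
  fun _ ⟨hw, u, hu, ha, _⟩ => ⟨hw, u, hu, ha⟩

theorem descentCandidates_revealed (g : V → R) (v : V) (l : List V) (G : SimpleGraph V) :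
    descentCandidates g v l (revealed G {x | x ∈ l}) = descentCandidates g v l G := by
  ext w
  simp only [descentCandidates, revealed, Set.mem_ofPred_eq]
  grind

theorem isLocalFamily_descentProcess (v : V) :
    IsLocalFamily (descentProcess v : (V → R) → ExposureProcess V) := by
  intro g g' G l h
  have hc : descentCandidates g v l G = descentCandidates g' v l G := by
    ext w
    simp only [descentCandidates, Set.mem_ofPred_eq]
    refine and_congr_right fun hw => exists_congr fun u => and_congr_right fun hu =>
      and_congr_right fun ha => ?_
    rw [h u (Or.inl hu), h w (Or.inr ⟨hw, u, hu, ha⟩)]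
  refine pickProcess_congr ?_
  ext m
  simp only [descentCandidates_revealed, ← hc]
  refine and_congr_right fun hm => forall₂_congr fun w hw => ?_
  rw [h m (Or.inr (descentCandidates_subset g v l G hm)),
    h w (Or.inr (descentCandidates_subset g v l G hw))]

theorem descentProcess_nil (v : V) (g : V → R) (H : SimpleGraph V) :
    descentProcess v g [] H = some v := pickProcess_nil _ _ _

/-- With no candidate left, the exposed set is closed under passing to preceding neighbours.
Ignoring the tie-break by vertex and the label of `v` only enlarges this set. -/
theorem relevantVicinity_subset_of_descentProcess_halt [Finite V] [LinearOrder V]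
    {G : SimpleGraph V} {v : V} {g : V → R} {K : ℕ}
    (h : exposedList (descentProcess v g) G (K + 1) = exposedList (descentProcess v g) G K) :
    relevantVicinity G g v ⊆ exposedSet (descentProcess v g) G K := by
  obtain ⟨hv, hno⟩ := not_exists_of_halt
    (fun l H m hm => descentCandidates_subset g v l H hm.1) h
  refine relevantVicinity_subset hv fun u hu w ha hp => ?_
  by_contra hw
  have hne : (descentCandidates g v (exposedList (descentProcess v g) G K) G).Nonempty :=
    ⟨w, hw, u, hu, ha, Or.inr hp.label_le⟩
  obtain ⟨m, hm, hmax⟩ := Set.exists_max_image _ g (Set.toFinite _) hne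
  refine hno m ?_
  rw [← descentCandidates_revealed] at hm hmax
  exact ⟨hm, hmax⟩

/-- Labels of the vertices exposed by the descent process are nonincreasing, `v` excepted. -/
theorem descentProcess_sorted (v : V) (g : V → R) (G : SimpleGraph V) (t : ℕ) :
    (exposedList (descentProcess v g) G t).Pairwise (fun y x => x = v ∨ g y ≤ g x) ∧
      ∀ w ∈ descentCandidates g v (exposedList (descentProcess v g) G t) G,
        ∀ x ∈ exposedList (descentProcess v g) G t, x = v ∨ g w ≤ g x := by
  induction t with
  | zero => simp [exposedList]
  | succ t ih =>
    obtain ⟨ih1, ih2⟩ := ih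
    rw [exposedList_succ]
    have hvl : exposedList (descentProcess v g) G t ≠ [] →
        v ∈ exposedList (descentProcess v g) G t := fun h =>
      mem_exposedList_of_ne_nil (descentProcess_nil v g) h
    rcases exposeStep_cases (descentProcess v g) G (exposedList (descentProcess v g) G t) with
      h | ⟨u, hu, hu', h⟩
    · rw [h]
      exact ⟨ih1, ih2⟩
    · rw [h]
      set l := exposedList (descentProcess v g) G t
      by_cases hl : l = []
      · rw [hl, descentProcess_nil] at hu
        rw [hl, ← Option.some_inj.1 hu]
        simp
      · have hvl := hvl hl
        obtain ⟨huc, hmax⟩ := pickProcess_spec hl hu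
        rw [descentCandidates_revealed] at huc hmax
        refine ⟨List.pairwise_cons.2 ⟨fun x hx => ih2 u huc x hx, ih1⟩, ?_⟩
        rintro w ⟨hw, y, hy, ha, hyw⟩ x hx
        have hwl : w ∉ l := fun h => hw (List.mem_cons_of_mem u h)
        have huv : u ≠ v := fun h => huc.1 (h ▸ hvl)
        -- A candidate after exposing `u` is either a neighbour of `u` with label at most that of
        -- `u`, or was a candidate before and lost to `u` by maximality.
        have hwu : g w ≤ g u := by
          rcases List.mem_cons.1 hy with rfl | hy
          · exact hyw.resolve_left huv
          · exact hmax w ⟨hwl, y, hy, ha, hyw⟩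
        rcases List.mem_cons.1 hx with rfl | hx
        · exact Or.inr hwu
        · exact (ih2 u huc x hx).imp_right hwu.trans

end Descent

/-! ### A long descent crowds some label. -/

section Crowding

open Classical

variable {V : Type*} {L : ℕ}

/-- If the descent process does not halt, some label is carried by at least half of the vertices
exposed by a suitable time. -/
theorem exists_crowded_label {v : V} {g : V → Fin L} {G : SimpleGraph V} {m : ℝ} (hm : 1 ≤ m)
    (h : exposedList (descentProcess v g) G (⌊2 ^ L * m⌋₊ + 1) ≠
      exposedList (descentProcess v g) G ⌊2 ^ L * m⌋₊) :
    ∃ j < L, ((⌊2 ^ (j + 1) * m⌋₊ + 1 : ℕ) : ℝ) / 2 ≤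
      ((exposedList (descentProcess v g) G (⌊2 ^ (j + 1) * m⌋₊ + 1)).countP
        fun x => x ≠ v ∧ (g x : ℕ) + (j + 1) = L) := by
  set K := ⌊2 ^ L * m⌋₊
  set l := exposedList (descentProcess v g) G (K + 1) with hl
  have hlen : l.length = K + 1 := length_exposedList_of_not_halt h le_rfl
  by_contra! hno
  -- Counts exposed vertices in the top `j` label classes, with `v` always included. If no label
  -- were crowded, induction would give at most 2^j m of them; at j = L this contradicts the K + 1
  -- exposed vertices.
  let N : ℕ → ℕ := fun j => l.countP fun x => x = v ∨ L ≤ (g x : ℕ) + j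
  have hN : ∀ j ≤ L, (N j : ℝ) ≤ 2 ^ j * m := by
    intro j
    induction j with
    | zero =>
      intro _
      have h1 : N 0 ≤ 1 := by
        have : N 0 = l.count v := by
          simp only [N, List.count]
          refine List.countP_congr fun x _ => ?_
          have := (g x).2
          simp only [add_zero, decide_eq_true_eq, beq_iff_eq]
          constructor
          · rintro (h | h)
            · exact h
            · omega
          · exact Or.inl
        rw [this]
        exact List.nodup_iff_count_le_one.1 (exposedList_nodup _ _ _) v
      have : (N 0 : ℝ) ≤ 1 := by exact_mod_cast h1
      simpa using this.trans hm
    | succ j ih =>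
      intro hj
      have ih := ih (by omega)
      by_contra! hbig
      set t := ⌊2 ^ (j + 1) * m⌋₊ + 1 with ht
      have htN : t ≤ N (j + 1) := (Nat.floor_lt (by positivity)).2 hbig
      have htK : t ≤ K + 1 := by rw [← hlen]; exact htN.trans List.countP_le_length
      set s := exposedList (descentProcess v g) G t with hs
      have hslen : s.length = t := length_exposedList_of_not_halt h htK
      obtain ⟨e, he⟩ := exposedList_suffix (descentProcess v g) G htK
      have hvs : v ∈ s := mem_exposedList_of_starts (descentProcess_nil v g) G _
      have hsort := (descentProcess_sorted v g G (K + 1)).1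
      have hnodup := exposedList_nodup (descentProcess v g) G (K + 1)
      rw [← he, List.pairwise_append] at hsort
      rw [← he, List.nodup_append] at hnodup
      -- An `x` among the first `t` vertices with a lower label would force all later labels (the
      -- part `e`) below the top `j + 1` classes; then fewer than `t` vertices would be counted by
      -- `N (j + 1)`.
      have hall : ∀ x ∈ s, x = v ∨ L ≤ (g x : ℕ) + (j + 1) := by
        intro x hx
        by_contra! hxn
        have h1 : e.countP (fun x => decide (x = v ∨ L ≤ (g x : ℕ) + (j + 1))) = 0 := by
          rw [List.countP_eq_zero]
          intro y hy
          have hyx := (hsort.2.2 y hy x hx).resolve_left hxn.1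
          have hyv : y ≠ v := hnodup.2.2 y hy v hvs
          have : (g y : ℕ) ≤ g x := hyx
          simp only [decide_eq_true_eq, hyv, false_or]
          omega
        have h2 : s.countP (fun x => decide (x = v ∨ L ≤ (g x : ℕ) + (j + 1))) < s.length := by
          refine lt_of_le_of_ne List.countP_le_length fun heq => ?_
          have := List.countP_eq_length.1 heq x hx
          simp only [decide_eq_true_eq] at this
          rcases this with h | h
          · exact hxn.1 h
          · omega
        have h3 : N (j + 1) = e.countP (fun x => decide (x = v ∨ L ≤ (g x : ℕ) + (j + 1))) +
            s.countP (fun x => decide (x = v ∨ L ≤ (g x : ℕ) + (j + 1))) := by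
          simp only [N]
          rw [hl, ← he, List.countP_append]
        omega
      -- The first `t` vertices lie in the top `j` classes, where there are at most 2^j m < t/2 by
      -- induction, or carry exactly the next label, with fewer than t/2 by assumption.
      have h4 : s.length ≤ s.countP (fun x => decide (x = v ∨ L ≤ (g x : ℕ) + j)) +
          s.countP (fun x => decide (x ≠ v ∧ (g x : ℕ) + (j + 1) = L)) := by
        rw [List.length_eq_countP_add_countP (fun x => decide (x = v ∨ L ≤ (g x : ℕ) + j))]
        refine Nat.add_le_add_left (List.countP_mono_left fun x hx hxn => ?_) _
        have := hall x hx
        simp only [decide_eq_true_eq, not_or] at hxn ⊢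
        exact ⟨hxn.1, by have := this.resolve_left hxn.1; omega⟩
      have h5 : s.countP (fun x => decide (x = v ∨ L ≤ (g x : ℕ) + j)) ≤ N j := by
        simp only [N]
        rw [hl, ← he, List.countP_append]
        exact Nat.le_add_left _ _
      have h6 := hno j (by omega)
      have h7 : 2 ^ (j + 1) * m < (t : ℝ) := by
        rw [ht]
        push_cast
        exact Nat.lt_floor_add_one _
      have h8 : (t : ℝ) ≤ N j +
          s.countP (fun x => decide (x ≠ v ∧ (g x : ℕ) + (j + 1) = L)) := by
        rw [← hslen]
        exact_mod_cast h4.trans (Nat.add_le_add_right h5 _)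
      rw [pow_succ] at h7
      linarith
  have hfin := hN L le_rfl
  have hNL : N L = K + 1 := by
    rw [← hlen]
    refine List.countP_eq_length.2 fun x _ => ?_
    simp
  rw [hNL] at hfin
  have := Nat.lt_floor_add_one (2 ^ L * m)
  push_cast at hfin
  linarith

theorem countP_exposedList_le [Finite V] (P : ExposureProcess V) (G : SimpleGraph V) (t : ℕ)
    (p : V → Prop) [DecidablePred p] :
    (exposedList P G t).countP (fun x => decide (p x)) ≤ {x | x ∈ seenSet P G t ∧ p x}.ncard := by
  rw [List.countP_eq_length_filter,
    ← List.toFinset_card_of_nodup ((exposedList_nodup P G t).filter _), ← Set.ncard_coe_finset]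
  refine Set.ncard_le_ncard (fun x hx => ?_) (Set.toFinite _)
  simp only [List.coe_toFinset, List.mem_filter, decide_eq_true_eq, Set.mem_ofPred_eq] at hx
  exact ⟨exposedSet_subset_seenSet P G t hx.1, hx.2⟩

end Crowding

/-! ### Simulating a process by an adaptive distinguisher. -/

section Simulation

open Classical

variable {V R : Type*}

/-- Query a list of points, recording the replies. -/
noncomputable def queryAll : List V → (V → R) → ((V → R) → Distinguisher V R) → Distinguisher V R
  | [], f, D => D f
  | x :: xs, f, D => .query x fun r => queryAll xs (Function.update f x r) D

theorem queryAll_spec (F : V → R) (D : (V → R) → Distinguisher V R) (xs : List V) (f : V → R) :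
    ∃ f' : V → R, (∀ x ∈ xs, f' x = F x) ∧ (∀ x, f x = F x → f' x = F x) ∧
      (queryAll xs f D).run F = (D f').run F ∧
      (queryAll xs f D).numQueries F = xs.length + (D f').numQueries F := by
  induction xs generalizing f with
  | nil => exact ⟨f, by simp, fun _ h => h, rfl, by simp [queryAll]⟩
  | cons x xs ih =>
    obtain ⟨f', h1, h2, h3, h4⟩ := ih (Function.update f x (F x))
    refine ⟨f', ?_, fun y hy => h2 y ?_, h3, ?_⟩
    · intro y hy
      rcases List.mem_cons.1 hy with rfl | hy
      · exact h2 y (by simp)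
      · exact h1 y hy
    · by_cases hyx : y = x
      · subst hyx; simp
      · rw [Function.update_of_ne hyx, hy]
    · rw [queryAll, Distinguisher.numQueries, h4, List.length_cons]
      omega

variable [Fintype V]

/-- The distinguisher simulating `t` further iterations of a family of exposure processes on `G`
while querying the labels of the vertices seen; it accepts if more than `q` vertices are seen or
if the process does not halt. -/
noncomputable def simulate (P : (V → R) → ExposureProcess V) (G : SimpleGraph V) (q : ℕ) :
    ℕ → List V → (V → R) → Distinguisher V R
  | 0, l, f => .output (decide (exposeStep (P f) G l ≠ l))
  | t + 1, l, f =>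
    if ({x | x ∈ exposeStep (P f) G l} ∪ nbhd G {x | x ∈ exposeStep (P f) G l}).ncard ≤ q then
      queryAll (Set.toFinite (({x | x ∈ exposeStep (P f) G l} ∪
        nbhd G {x | x ∈ exposeStep (P f) G l}) \ ({x | x ∈ l} ∪ nbhd G {x | x ∈ l}))).toFinset.toList f
        (simulate P G q t (exposeStep (P f) G l))
    else .output true

/-- The invariant is that the recorded replies `f` agree with the oracle on everything seen, so by
locality each simulated iteration is the true one. Only newly seen vertices are queried, so queries
still to come plus vertices already seen never exceed `q`; the size check precedes the queries. -/
theorem simulate_spec {P : (V → R) → ExposureProcess V} (hP : IsLocalFamily P)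
    (G : SimpleGraph V) (q : ℕ) (F : V → R) (t i : ℕ) (f : V → R)
    (hf : ∀ x ∈ seenSet (P F) G i, F x = f x) (hq : (seenSet (P F) G i).ncard ≤ q) :
    (simulate P G q t (exposedList (P F) G i) f).numQueries F + (seenSet (P F) G i).ncard ≤ q ∧
    ((simulate P G q t (exposedList (P F) G i) f).run F = true →
      exposedList (P F) G (i + t + 1) ≠ exposedList (P F) G (i + t) ∨
        q < (seenSet (P F) G (i + t)).ncard) ∧
    (exposedList (P F) G (i + t + 1) ≠ exposedList (P F) G (i + t) →
      (simulate P G q t (exposedList (P F) G i) f).run F = true) := by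
  induction t generalizing i f with
  | zero =>
    have hstep : exposeStep (P f) G (exposedList (P F) G i) = exposedList (P F) G (i + 1) :=
      (hP.exposeStep_congr hf).symm
    simp only [simulate, hstep, Distinguisher.numQueries, Distinguisher.run, zero_add, add_zero,
      decide_eq_true_eq, imp_self, and_true]
    exact ⟨hq, Or.inl⟩
  | succ t ih =>
    have hstep : exposeStep (P f) G (exposedList (P F) G i) = exposedList (P F) G (i + 1) :=
      (hP.exposeStep_congr hf).symm
    have hsim : simulate P G q (t + 1) (exposedList (P F) G i) f =
        if (seenSet (P F) G (i + 1)).ncard ≤ q then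
          queryAll (Set.toFinite (seenSet (P F) G (i + 1) \ seenSet (P F) G i)).toFinset.toList f
            (simulate P G q t (exposedList (P F) G (i + 1)))
        else .output true := by
      simp only [simulate, hstep]
      rfl
    rw [hsim]
    split_ifs with hq'
    · obtain ⟨f', h1, h2, h3, h4⟩ := queryAll_spec F
        (simulate P G q t (exposedList (P F) G (i + 1)))
        (Set.toFinite (seenSet (P F) G (i + 1) \ seenSet (P F) G i)).toFinset.toList f
      have hf' : ∀ x ∈ seenSet (P F) G (i + 1), F x = f' x := by
        intro x hx
        by_cases hxi : x ∈ seenSet (P F) G i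
        · exact (h2 x (hf x hxi).symm).symm
        · exact (h1 x (by simp [hx, hxi])).symm
      obtain ⟨k1, k2, k3⟩ := ih (i + 1) f' hf' hq'
      rw [h3, h4, Finset.length_toList, ← Set.ncard_eq_toFinset_card]
      have hcard := Set.ncard_sdiff_add_ncard_of_subset
        (seenSet_mono (P F) G (Nat.le_succ i)) (Set.toFinite _)
      rw [show i + (t + 1) = i + 1 + t by omega]
      refine ⟨?_, k2, k3⟩
      simp only [Nat.succ_eq_add_one] at hcard
      omega
    · refine ⟨by simpa [Distinguisher.numQueries] using hq, fun _ => Or.inr ?_, fun _ => rfl⟩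
      refine lt_of_lt_of_le (not_le.1 hq') (Set.ncard_le_ncard ?_ (Set.toFinite _))
      exact seenSet_mono _ _ (by omega)

/-- Replacing uniformly random labels by almost adaptively independent ones. -/
theorem IsAdaptiveDependent.real_not_halt_le [Finite R] [Nonempty R] [MeasurableSpace R]
    {ℋ : Measure (V → R)} [IsProbabilityMeasure ℋ] {q : ℕ} {ε : ℝ}
    (hℋ : IsAdaptiveDependent ℋ q ε) {P : (V → R) → ExposureProcess V} (hP : IsLocalFamily P)
    (G : SimpleGraph V) (K : ℕ) :
    ℋ.real {F | exposedList (P F) G (K + 1) ≠ exposedList (P F) G K} ≤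
      ({F | exposedList (P F) G (K + 1) ≠ exposedList (P F) G K}.ncard : ℝ) / Nat.card (V → R) +
      ({F | q < (seenSet (P F) G K).ncard}.ncard : ℝ) / Nat.card (V → R) + ε := by
  obtain ⟨f⟩ : Nonempty (V → R) := inferInstance
  have h0 : ∀ F, seenSet (P F) G 0 = ∅ := fun F => by
    simp [seenSet, exposedSet, exposedList, nbhd]
  have hspec := fun F => simulate_spec hP G q F K 0 f (by simp [h0]) (by simp [h0])
  simp only [h0, Set.ncard_empty, zero_add, add_zero] at hspec
  have hD := hℋ (simulate P G q K [] f) fun F => (hspec F).1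
  have h1 : ℋ.real {F | exposedList (P F) G (K + 1) ≠ exposedList (P F) G K} ≤
      ℋ.real {F | (simulate P G q K [] f).run F = true} :=
    measureReal_mono fun F hF => (hspec F).2.2 hF
  have h2 : {F | (simulate P G q K [] f).run F = true}.ncard ≤
      {F | exposedList (P F) G (K + 1) ≠ exposedList (P F) G K}.ncard +
      {F | q < (seenSet (P F) G K).ncard}.ncard :=
    le_trans (Set.ncard_le_ncard (fun F hF => (hspec F).2.1 hF) (Set.toFinite _))
      (Set.ncard_union_le _ _)
  have h3 : ({F | (simulate P G q K [] f).run F = true}.ncard : ℝ) / Nat.card (V → R) ≤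
      (({F | exposedList (P F) G (K + 1) ≠ exposedList (P F) G K}.ncard : ℝ) +
      ({F | q < (seenSet (P F) G K).ncard}.ncard : ℝ)) / Nat.card (V → R) := by
    gcongr
    exact_mod_cast h2
  rw [add_div] at h3
  linarith [(abs_le.1 hD).2]

end Simulation

/-! ### Numerical bounds and conclusion. -/

section Assembly

open Classical

theorem real_prod_eq_sum {V Ω : Type*} [Fintype V] [Fintype (SimpleGraph V)]
    [Finite Ω] [MeasurableSpace Ω]
    [DiscreteMeasurableSpace Ω] (𝒢 : Measure (SimpleGraph V)) [IsProbabilityMeasure 𝒢]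
    (ℋ : Measure Ω) [IsProbabilityMeasure ℋ] (s : Set (SimpleGraph V × Ω)) :
    (𝒢.prod ℋ).real s = ∑ G, 𝒢.real {G} * ℋ.real {F | (G, F) ∈ s} := by
  rw [measureReal_def, Measure.prod_apply .of_discrete, lintegral_fintype,
    ENNReal.toReal_sum fun G _ => ENNReal.mul_ne_top (measure_ne_top _ _) (measure_ne_top _ _)]
  refine Finset.sum_congr rfl fun G _ => ?_
  rw [ENNReal.toReal_mul, mul_comm]
  rfl

theorem exp_neg_mul_log_le {n : ℕ} (hn : 2 ≤ n) {x : ℝ} {N : ℕ} (hx : N * Real.log n ≤ x) :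
    Real.exp (-x) ≤ 1 / (n : ℝ) ^ N := by
  have hn0 : (0 : ℝ) < n := by positivity
  calc Real.exp (-x) ≤ Real.exp (-(N * Real.log n)) := Real.exp_le_exp.2 (by linarith)
    _ = 1 / (n : ℝ) ^ N := by
      rw [Real.exp_neg, Real.exp_nat_mul, Real.exp_log hn0, one_div]

theorem ncard_seenSet_sdiff {V : Type*} [Finite V] {P : ExposureProcess V} {G : SimpleGraph V}
    {t s : ℕ} (h : s < (seenSet P G t).ncard) (v : V) : s ≤ (seenSet P G t \ {v}).ncard := by
  have := Set.pred_ncard_le_ncard_sdiff_singleton (seenSet P G t) v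
  omega

/-- Components of a `d`-light random graph with `d < 1 / 24` have an exponential tail. -/
theorem sum_not_halt_componentProcess_le {V : Type*} [Fintype V] [Fintype (SimpleGraph V)]
    {𝒢 : Measure (SimpleGraph V)}
    [IsProbabilityMeasure 𝒢] {d : ℝ} (hlight : IsLight 𝒢 d) (hd : d < 1 / 24) (v : V) (K : ℕ)
    (hK : 1 ≤ K) :
    ∑ G, 𝒢.real {G} * Set.indicator {G | exposedList (componentProcess v) G (K + 1) ≠
      exposedList (componentProcess v) G K} 1 G ≤ 4 * Real.exp (-K) := by
  -- Trivial labels reduce the tail bound to the graph alone. Not halting means K vertices are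
  -- exposed, K - 1 of them different from `v`; with weight 4 the bound is 4 exp(3dK - K log 4), and
  -- 1/8 - log 4 < -1.
  have h := sum_mul_ncard_le_of_card_seen (R := Unit) hlight (P := fun _ => componentProcess v)
    (fun _ _ _ _ _ => rfl) (v := v) (fun _ => pickProcess_nil v _) (b := 4) (by norm_num) K (K - 1)
    (A := fun G _ => exposedList (componentProcess v) G (K + 1) ≠
      exposedList (componentProcess v) G K) (fun G _ hG => by
        refine ncard_seenSet_sdiff ?_ v
        have h1 := length_exposedList_of_not_halt hG (Nat.le_succ K)
        rw [← ncard_exposedSet] at h1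
        have := Set.ncard_le_ncard (exposedSet_subset_seenSet (componentProcess v) G K)
          (Set.toFinite _)
        omega)
  refine le_trans (le_of_eq ?_) (h.trans ?_)
  · refine Finset.sum_congr rfl fun G _ => ?_
    congr 1
    rw [Set.indicator_apply]
    split_ifs with hG <;> simp_all
  · have hcard : Nat.card (V → Unit) = 1 := by simp
    have h4' : (4 : ℝ) = Real.exp (2 * Real.log 2) := by
      rw [two_mul, Real.exp_add, Real.exp_log two_pos]
      norm_num
    have h4 : (4 : ℝ) ^ (K - 1) = Real.exp ((K - 1) * (2 * Real.log 2)) := by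
      rw [show ((K : ℝ) - 1) = ((K - 1 : ℕ) : ℝ) by push_cast [hK]; ring, Real.exp_nat_mul, ← h4']
    have hlog := Real.log_two_gt_d9
    have hK' : (1 : ℝ) ≤ K := by exact_mod_cast hK
    rw [hcard, Nat.cast_one, mul_one, h4, ← Real.exp_sub]
    nth_rw 2 [h4']
    rw [← Real.exp_add, Real.exp_le_exp]
    nlinarith

/-- On uniformly random labels, the descent process halts early with high probability. -/
theorem sum_not_halt_descentProcess_le {V : Type*} [Fintype V] [Fintype (SimpleGraph V)]
    {𝒢 : Measure (SimpleGraph V)}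
    [IsProbabilityMeasure 𝒢] {d : ℝ} (hlight : IsLight 𝒢 d) (v : V) {L : ℕ} (hL : 24 * d < L)
    {m : ℝ} (hm : 1 ≤ m) :
    ∑ G, 𝒢.real {G} * ({g : V → Fin L |
      exposedList (descentProcess v g) G (⌊2 ^ L * m⌋₊ + 1) ≠
        exposedList (descentProcess v g) G ⌊2 ^ L * m⌋₊}.ncard : ℝ) ≤
      L * Real.exp (-m) * Nat.card (V → Fin L) := by
  have hd := hlight.1
  have hL0 : (0 : ℝ) < L := by linarith
  have : NeZero L := ⟨by rintro rfl; simp at hL0⟩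
  -- The index `r` counts label classes from the top, so the crowded label is `r.rev`, that is L -
  -- (r + 1).
  let A : Fin L → SimpleGraph V → (V → Fin L) → Prop := fun r G g =>
    ((⌊2 ^ ((r : ℕ) + 1) * m⌋₊ + 1 : ℕ) : ℝ) / 2 ≤
      ({u | u ∈ seenSet (descentProcess v g) G (⌊2 ^ ((r : ℕ) + 1) * m⌋₊ + 1) ∧ u ≠ v ∧
        g u = r.rev}.ncard : ℝ)
  have hA : ∀ r, ∑ G, 𝒢.real {G} * ({g | A r G g}.ncard : ℝ) ≤
      Real.exp (-m) * Nat.card (V → Fin L) := by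
    intro r
    set t := ⌊2 ^ ((r : ℕ) + 1) * m⌋₊ + 1 with ht
    have h := sum_mul_ncard_le_of_card_label hlight (isLocalFamily_descentProcess (R := Fin L) v)
      (descentProcess_nil v) r.rev (b := 4) (by norm_num) t (s := (t : ℝ) / 2) (A := A r)
      fun G g hg => hg
    refine h.trans (mul_le_mul_of_nonneg_right ?_ (Nat.cast_nonneg _))
    have htm : 2 * m ≤ t := by
      have h1 : 2 ^ ((r : ℕ) + 1) * m < t := by
        rw [ht]
        push_cast
        exact Nat.lt_floor_add_one _
      have h2 : (1 : ℝ) ≤ 2 ^ (r : ℕ) := one_le_pow₀ (by norm_num)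
      rw [pow_succ] at h1
      nlinarith
    have hlog := Real.log_two_gt_d9
    have h4 : (4 : ℝ) ^ ((t : ℝ) / 2) = Real.exp (t * Real.log 2) := by
      rw [Real.rpow_def_of_pos (by norm_num), show (4 : ℝ) = 2 ^ 2 by norm_num, Real.log_pow]
      congr 1
      push_cast
      ring
    have hdL : d * ((4 - 1) / (Fintype.card (Fin L) : ℝ)) ≤ 1 / 8 := by
      rw [Fintype.card_fin, ← mul_div_assoc, div_le_iff₀ hL0]
      linarith
    -- The exponent is at most t(1/8 - log 2) ≤ -t/2 ≤ -m.
    rw [h4, ← Real.exp_sub, Real.exp_le_exp]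
    have h5 := mul_le_mul_of_nonneg_left hdL (Nat.cast_nonneg (α := ℝ) t)
    nlinarith
  have hcard : ∀ G, ({g : V → Fin L |
      exposedList (descentProcess v g) G (⌊2 ^ L * m⌋₊ + 1) ≠
        exposedList (descentProcess v g) G ⌊2 ^ L * m⌋₊}.ncard : ℝ) ≤
      ∑ r, ({g | A r G g}.ncard : ℝ) := by
    intro G
    have : {g : V → Fin L |
      exposedList (descentProcess v g) G (⌊2 ^ L * m⌋₊ + 1) ≠
        exposedList (descentProcess v g) G ⌊2 ^ L * m⌋₊}.ncard ≤
      ∑ r, {g | A r G g}.ncard := by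
      refine (Set.ncard_le_ncard (fun g hg => ?_) (Set.toFinite _)).trans
        (Set.ncard_iUnion_le_of_fintype fun r => {g | A r G g})
      obtain ⟨j, hj, hcr⟩ := exists_crowded_label hm hg
      refine Set.mem_iUnion.2 ⟨⟨j, hj⟩, hcr.trans ?_⟩
      refine Nat.cast_le.2 ((countP_exposedList_le _ _ _ _).trans (le_of_eq ?_))
      congr 1
      ext u
      simp only [Set.mem_ofPred_eq, Fin.ext_iff, Fin.val_rev]
      have := (g u).2
      refine and_congr_right fun _ => and_congr_right fun _ => ?_
      omega
    exact_mod_cast this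
  calc _ ≤ ∑ G, 𝒢.real {G} * ∑ r, ({g | A r G g}.ncard : ℝ) :=
        Finset.sum_le_sum fun G _ => mul_le_mul_of_nonneg_left (hcard G) measureReal_nonneg
    _ = ∑ r, ∑ G, 𝒢.real {G} * ({g | A r G g}.ncard : ℝ) := by
        simp only [Finset.mul_sum]
        exact Finset.sum_comm
    _ ≤ ∑ _r : Fin L, Real.exp (-m) * Nat.card (V → Fin L) :=
        Finset.sum_le_sum fun r _ => hA r
    _ = L * Real.exp (-m) * Nat.card (V → Fin L) := by
        rw [Finset.sum_const, Finset.card_univ, Fintype.card_fin, nsmul_eq_mul, mul_assoc]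

/-- On uniformly random labels, an exposure process sees few vertices with high probability. -/
theorem sum_many_seen_le {V R : Type*} [Fintype V] [Fintype (SimpleGraph V)] [Fintype R] [Nonempty R]
    {𝒢 : Measure (SimpleGraph V)} [IsProbabilityMeasure 𝒢] {d : ℝ} (hlight : IsLight 𝒢 d)
    {P : (V → R) → ExposureProcess V} (hP : IsLocalFamily P) {v : V}
    (hv : ∀ g H, P g [] H = some v) {κ : ℝ} (hκ : 0 ≤ κ) :
    ∑ G, 𝒢.real {G} *
      ({g | ⌊6 * d * κ⌋₊ < (seenSet (P g) G ⌊κ⌋₊).ncard}.ncard : ℝ) ≤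
      2 * Real.exp (-(3 * (d * κ))) * Nat.card (V → R) := by
  have hd := hlight.1
  -- With weight 2 the exponent is at most dκ - (6dκ - 1) log 2, and 6 log 2 > 4. The factor 2 in
  -- the result pays for rounding 6dκ down.
  have h := sum_mul_ncard_le_of_card_seen hlight hP hv (b := 2) (by norm_num) ⌊κ⌋₊ ⌊6 * d * κ⌋₊
    (A := fun G g => ⌊6 * d * κ⌋₊ < (seenSet (P g) G ⌊κ⌋₊).ncard)
    fun G g hg => ncard_seenSet_sdiff hg v
  refine h.trans (mul_le_mul_of_nonneg_right ?_ (Nat.cast_nonneg _))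
  have h2 : (2 : ℝ) ^ ⌊6 * d * κ⌋₊ = Real.exp (⌊6 * d * κ⌋₊ * Real.log 2) := by
    rw [Real.exp_nat_mul, Real.exp_log two_pos]
  have hlog := Real.log_two_gt_d9
  rw [h2, ← Real.exp_sub]
  rw [show 2 * Real.exp (-(3 * (d * κ))) = Real.exp (Real.log 2 + -(3 * (d * κ))) by
    rw [Real.exp_add, Real.exp_log two_pos], Real.exp_le_exp]
  have hfl := Nat.lt_floor_add_one (6 * d * κ)
  have hfκ : (⌊κ⌋₊ : ℝ) * d ≤ κ * d := mul_le_mul_of_nonneg_right (Nat.floor_le hκ) hd.le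
  have hdκ : 0 ≤ d * κ := mul_nonneg hd.le hκ
  have h3 : (6 * d * κ - 1) * Real.log 2 ≤ ⌊6 * d * κ⌋₊ * Real.log 2 :=
    mul_le_mul_of_nonneg_right (by linarith) (by linarith)
  nlinarith

/-- The random labels being almost adaptively independent, large relevant vicinities are rare. -/
theorem sum_real_large_vicinity_le {n : ℕ} [Fintype (SimpleGraph (Fin n))]
    (hn : 2 ≤ n) {d : ℝ}
    {𝒢 : Measure (SimpleGraph (Fin n))} [IsProbabilityMeasure 𝒢] (hlight : IsLight 𝒢 d)
    {L : ℕ} (hL : 24 * d < L) {m : ℝ} (hm : 16 * Real.log n ≤ m)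
    {ℋ : Measure (Fin n → Fin L)} [IsProbabilityMeasure ℋ]
    (hℋ : IsAdaptiveDependent ℋ ⌊6 * d * (2 ^ L * m)⌋₊ (1 / (2 * (n : ℝ) ^ 5))) (v : Fin n) :
    ∑ G, 𝒢.real {G} * ℋ.real {F | 2 ^ L * m < ((relevantVicinity G F v).ncard : ℝ)} ≤
      1 / (n : ℝ) ^ 5 := by
  have hd := hlight.1
  have hn' : (2 : ℝ) ≤ n := by exact_mod_cast hn
  have hn0 : (0 : ℝ) < n := by linarith
  have hlogn : 1 / 2 ≤ Real.log n := by
    have := Real.log_le_log two_pos hn'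
    linarith [Real.log_two_gt_d9]
  have hm1 : 8 ≤ m := by linarith
  have hLpos : 0 < L := by
    have : (0 : ℝ) < L := by linarith
    exact_mod_cast this
  have hLne : NeZero L := ⟨hLpos.ne'⟩
  set κ := 2 ^ L * m with hκ
  have hκm : 2 * m ≤ κ := by
    have : (2 : ℝ) ≤ 2 ^ L := le_self_pow₀ (by norm_num) hLpos.ne'
    nlinarith
  set K := ⌊κ⌋₊ with hK
  have hKκ : (K : ℝ) ≤ κ := Nat.floor_le (by linarith)
  have hsmall : ∀ {P : ExposureProcess (Fin n)} {G : SimpleGraph (Fin n)} {S : Set (Fin n)},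
      S ⊆ exposedSet P G K → (S.ncard : ℝ) ≤ κ := by
    intro P G S hS
    refine le_trans ?_ hKκ
    have := (Set.ncard_le_ncard hS (Set.toFinite _)).trans
      ((ncard_exposedSet P G K).le.trans (length_exposedList_le P G K))
    exact_mod_cast this
  have hpow : ∀ a : ℕ, (2 : ℝ) ^ a ≤ (n : ℝ) ^ a := fun a => pow_le_pow_left₀ two_pos.le hn' a
  -- For small d the quantity dκ may be too small to control the number of queries, so the component
  -- bound is used and the labels are ignored.
  rcases lt_or_ge d (1 / 24) with hd' | hd'
  · have hK1 : κ < K + 1 := Nat.lt_floor_add_one κ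
    have hK1' : 1 ≤ K := (Nat.one_le_floor_iff κ).2 (by linarith)
    calc _ ≤ ∑ G, 𝒢.real {G} * Set.indicator {G | exposedList (componentProcess v) G (K + 1) ≠
          exposedList (componentProcess v) G K} 1 G := by
          refine Finset.sum_le_sum fun G _ => mul_le_mul_of_nonneg_left ?_ measureReal_nonneg
          by_cases hG : exposedList (componentProcess v) G (K + 1) =
            exposedList (componentProcess v) G K
          swap
          · rw [Set.indicator_of_mem (by exact hG)]
            exact measureReal_le_one
          · rw [Set.indicator_of_notMem (by simpa using hG)]
            refine le_of_eq ((measureReal_eq_zero_iff).2 ?_)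
            rw [show {F : Fin n → Fin L | κ < ((relevantVicinity G F v).ncard : ℝ)} = ∅ from
              Set.eq_empty_of_forall_notMem fun F hF => not_le.2 hF
                (hsmall (relevantVicinity_subset_of_componentProcess_halt hG F)),
              measure_empty]
      _ ≤ 4 * Real.exp (-K) := sum_not_halt_componentProcess_le hlight hd' v K hK1'
      _ ≤ 4 * (1 / (n : ℝ) ^ 7) := by
          gcongr
          exact exp_neg_mul_log_le hn (by push_cast; linarith)
      _ ≤ 1 / (n : ℝ) ^ 5 := by
          rw [mul_one_div, div_le_div_iff₀ (by positivity) (by positivity)]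
          have := mul_le_mul_of_nonneg_right (hpow 2) (pow_nonneg hn0.le 5)
          linarith [pow_add (n : ℝ) 2 5]
  -- If L > n then κ ≥ 2^L ≥ n and the size bound is trivial; otherwise L ≤ n, and the union bound
  -- over labels costs only a factor n.
  rcases lt_or_ge n L with hnL | hnL
  · have hbig : (n : ℝ) ≤ κ := by
      have h1 : (L : ℝ) ≤ 2 ^ L := by exact_mod_cast Nat.lt_two_pow_self.le
      have h2 : (n : ℝ) ≤ L := by exact_mod_cast hnL.le
      nlinarith
    refine le_trans (le_of_eq (Finset.sum_eq_zero fun G _ => ?_)) (by positivity)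
    rw [show {F : Fin n → Fin L | κ < ((relevantVicinity G F v).ncard : ℝ)} = ∅ from
      Set.eq_empty_of_forall_notMem fun F hF => by
        have h := Set.ncard_le_card (relevantVicinity G F v)
        rw [Nat.card_eq_fintype_card, Fintype.card_fin] at h
        have h' : ((relevantVicinity G F v).ncard : ℝ) ≤ n := by exact_mod_cast h
        exact not_le.2 hF (h'.trans hbig), measureReal_empty, mul_zero]
  · have hN : (0 : ℝ) < Nat.card (Fin n → Fin L) := by exact_mod_cast Nat.card_pos
    have h1 := sum_not_halt_descentProcess_le hlight v hL (m := m) (by linarith)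
    have h2 := sum_many_seen_le hlight (isLocalFamily_descentProcess (R := Fin L) v)
      (descentProcess_nil v) (κ := κ) (by linarith)
    rw [← div_le_iff₀ hN, Finset.sum_div] at h1 h2
    simp only [mul_div_assoc] at h1 h2
    have hL2 : 2 ≤ L := by
      have : (1 : ℝ) < L := by linarith
      exact_mod_cast this
    have hκ4 : 4 * m ≤ κ := by
      have : (2 : ℝ) ^ 2 ≤ 2 ^ L := pow_le_pow_right₀ (by norm_num) hL2
      nlinarith
    -- From d ≥ 1/24 and κ ≥ 4m; the latter uses L ≥ 2, which follows from L > 24d ≥ 1.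
    have hdκ : m / 2 ≤ 3 * (d * κ) := by nlinarith
    have hLn : (L : ℝ) ≤ n := by exact_mod_cast hnL
    have e1 : L * Real.exp (-m) ≤ 1 / (4 * (n : ℝ) ^ 5) := by
      calc L * Real.exp (-m) ≤ n * (1 / (n : ℝ) ^ 8) := by
            gcongr
            exact exp_neg_mul_log_le hn (by push_cast; linarith)
        _ ≤ 1 / (4 * (n : ℝ) ^ 5) := by
            rw [mul_one_div, div_le_div_iff₀ (by positivity) (by positivity)]
            have := mul_le_mul_of_nonneg_right (hpow 2) (pow_nonneg hn0.le 6)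
            nlinarith [pow_add (n : ℝ) 2 6, pow_succ' (n : ℝ) 5]
    have e2 : 2 * Real.exp (-(3 * (d * κ))) ≤ 1 / (4 * (n : ℝ) ^ 5) := by
      calc 2 * Real.exp (-(3 * (d * κ))) ≤ 2 * (1 / (n : ℝ) ^ 8) := by
            gcongr
            exact exp_neg_mul_log_le hn (by push_cast; linarith)
        _ ≤ 1 / (4 * (n : ℝ) ^ 5) := by
            rw [mul_one_div, div_le_div_iff₀ (by positivity) (by positivity)]
            have := mul_le_mul_of_nonneg_right (hpow 3) (pow_nonneg hn0.le 5)
            linarith [pow_add (n : ℝ) 3 5]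
    calc _ ≤ ∑ G, 𝒢.real {G} *
          (({F : Fin n → Fin L | exposedList (descentProcess v F) G (K + 1) ≠
            exposedList (descentProcess v F) G K}.ncard : ℝ) / Nat.card (Fin n → Fin L) +
          ({F : Fin n → Fin L | ⌊6 * d * κ⌋₊ <
            (seenSet (descentProcess v F) G K).ncard}.ncard : ℝ) / Nat.card (Fin n → Fin L) +
          1 / (2 * (n : ℝ) ^ 5)) := by
          refine Finset.sum_le_sum fun G _ => mul_le_mul_of_nonneg_left ?_ measureReal_nonneg
          refine le_trans (measureReal_mono fun F hF => ?_)
            (hℋ.real_not_halt_le (isLocalFamily_descentProcess v) G K)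
          intro hhalt
          exact not_le.2 hF (hsmall (relevantVicinity_subset_of_descentProcess_halt hhalt))
      _ ≤ L * Real.exp (-m) + 2 * Real.exp (-(3 * (d * κ))) + 1 / (2 * (n : ℝ) ^ 5) := by
          simp only [mul_add, Finset.sum_add_distrib]
          rw [← Finset.sum_mul, sum_measureReal_singleton, Finset.coe_univ, probReal_univ, one_mul]
          exact add_le_add_left (add_le_add h1 h2) _
      _ ≤ 1 / (4 * (n : ℝ) ^ 5) + 1 / (4 * (n : ℝ) ^ 5) + 1 / (2 * (n : ℝ) ^ 5) := by
          gcongr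
      _ = 1 / (n : ℝ) ^ 5 := by
          field_simp
          norm_num

end Assembly

theorem mainTheorem2 :
    ∃ c₀ : ℝ, 0 < c₀ ∧ ∀ c : ℝ, c₀ ≤ c →
      ∀ (n : ℕ), 2 ≤ n →
      ∀ (d : ℝ) (𝒢 : Measure (SimpleGraph (Fin n))) [IsProbabilityMeasure 𝒢], IsLight 𝒢 d →
      ∀ (L : ℕ), 24 * d < L →
      ∀ (κ k : ℝ), κ = 2 ^ L * c * Real.log n → k = 6 * d * κ →
      ∀ (ℋ : Measure (Fin n → Fin L)) [IsProbabilityMeasure ℋ],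
        IsAdaptiveDependent ℋ ⌊k⌋₊ (1 / (2 * (n : ℝ) ^ 5)) →
      ∀ v : Fin n,
        1 - 1 / (n : ℝ) ^ 4 + 1 / (n : ℝ) ^ 5 ≤
          (𝒢.prod ℋ).real {x | ((relevantVicinity x.1 x.2 v).ncard : ℝ) ≤ κ} := by
  -- With m ≥ 16 log n the weakest exponent, m/2, still gives n^(-8), enough to absorb the constants
  -- since n ≥ 2.
  refine ⟨16, by norm_num, ?_⟩
  intro c hc n hn d 𝒢 _ hlight L hL κ k hκ hk ℋ _ hℋ v
  have hn' : (2 : ℝ) ≤ n := by exact_mod_cast hn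
  have hκ' : κ = 2 ^ L * (c * Real.log n) := by rw [hκ, mul_assoc]
  have hlog : 0 ≤ Real.log n := Real.log_natCast_nonneg n
  rw [hk, hκ'] at hℋ
  have h := sum_real_large_vicinity_le hn hlight hL (m := c * Real.log n)
    (mul_le_mul_of_nonneg_right hc hlog) hℋ v
  rw [← hκ'] at h
  have hcompl := probReal_compl_eq_one_sub (μ := 𝒢.prod ℋ)
    (s := {x | ((relevantVicinity x.1 x.2 v).ncard : ℝ) ≤ κ}) .of_discrete
  rw [real_prod_eq_sum] at hcompl
  simp only [Set.mem_compl_iff, Set.mem_ofPred_eq, not_le] at hcompl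
  -- The failure probability is at most 1/n^5, and n ≥ 2 gives 1/n^5 ≤ 1/n^4 - 1/n^5.
  have h45 : 2 * (1 / (n : ℝ) ^ 5) ≤ 1 / (n : ℝ) ^ 4 := by
    rw [mul_one_div, div_le_div_iff₀ (by positivity) (by positivity), one_mul, pow_succ' _ 4]
    gcongr
  linarith
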